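/- **Setting.** Let $f,g:\mathbb R^p\times\mathbb R^q\to\mathbb R$ ($q\ge 1$) be continuously differentiable with $\nabla_y g$ continuously differentiable, $y^*(x)=\arg\min_y g(x,y)$ and $\Phi(x)=f(x,y^*(x))$. Assume that there are constants $L_x,L_{xy},L_y,\widetilde L_{xy},\widetilde L_y,\rho_{xy},\rho_{yy}\ge 0$ such that $\nabla_x f$ is $L_x$-Lipschitz in $x$ and $L_{xy}$-Lipschitz in $y$; $\nabla_y f$ is $L_{xy}$-Lipschitz in $x$ and $L_y$-Lipschitz in $y$; $\nabla_y g$ is $\widetilde L_{xy}$-Lipschitz in $x$ and $\widetilde L_y$-Lipschitz in $y$; $\nabla_x\nabla_y g$ and $\nabla_y^2 g$ are $\rho_{xy}$- and $\rho_{yy}$-Lipschitz in $(x,y)$. Assume that $g(x,\cdot)$ is $\mu_y$-strongly convex for every $x$, that $\Phi$ is $\mu_x$-strongly convex ($\mu_x,\mu_y>0$), that its minimizer $x^*$ satisfies $\|x^*\|=B$ for some $B>0$, and that $\|\nabla_y f(x,y)\|\le U$ for all $(x,y)$. Put $\kappa_y=\widetilde L_y/\mu_y$ and $$L_\Phi=L_x+\frac{2L_{xy}\widetilde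 L_{xy}}{\mu_y}+\Big(\frac{U\rho_{xy}}{\mu_y}+\frac{U\widetilde L_{xy}\rho_{yy}}{\mu_y^2}\Big)\Big(1+\frac{\widetilde L_{xy}}{\mu_y}\Big)+\frac{\widetilde L_{xy}^2L_y}{\mu_y^2}.$$ **Algorithm AccBiO-BG.** Start from $x_0=z_0=0$ and $y_0^0=0$. For $k=0,1,2,\dots$: set $\widetilde x_k=\eta x_k+(1-\eta)z_k$ and, for $k>0$, $y_k^0=y_{k-1}^N$. With $s_k^0=y_k^0$, run for $t=1,\dots,N$ $$y_k^t=s_k^{t-1}-\tfrac1{\widetilde L_y}\nabla_y g(\widetilde x_k,s_k^{t-1}),\qquad s_k^t=\tfrac{2\sqrt{\kappa_y}}{\sqrt{\kappa_y}+1}y_k^t-\tfrac{\sqrt{\kappa_y}-1}{\sqrt{\kappa_y}+1}y_k^{t-1}.$$ Compute $v_k^M$ by the heavy-ball recursion $v_k^{t+1}=v_k^t-\lambda\nabla Q(v_k^t)+\theta(v_k^t-v_k^{t-1})$, $v_k^0=v_k^1=0$, for $Q(v)=\frac12v^T\nabla_y^2g(\widetilde x_k,y_k^N)v-v^T\nabla_yf(\widetilde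 x_k,y_k^N)$. Put $G_k=\nabla_xf(\widetilde x_k,y_k^N)-\nabla_x\nabla_yg(\widetilde x_k,y_k^N)v_k^M$, $x_{k+1}=\tau\widetilde x_k+(1-\tau)x_k-\beta G_k$, $z_{k+1}=\widetilde x_k-\alpha G_k$. The parameters are $$\eta=\frac{\sqrt{\alpha\mu_x}}{\sqrt{\alpha\mu_x}+2},\quad \tau=\frac{\sqrt{\alpha\mu_x}}2,\quad \beta=\sqrt{\frac{\alpha}{\mu_x}},\quad \lambda=\frac4{(\sqrt{\widetilde L_y}+\sqrt{\mu_y})^2},\quad \theta=\max\{(1-\sqrt{\lambda\mu_y})^2,(1-\sqrt{\lambda\widetilde L_y})^2\},$$ and a stepsize $\alpha$ with $\frac{c}{L_\Phi}\le\alpha\le\frac1{2L_\Phi}$, where $c>0$ is a fixed constant (for instance $c=\frac12$, $\alpha=\frac1{2L_\Phi}$). The complexity of a run that outputs $z_K$ is $\mathcal C=t\,(n_J+n_H)+n_G$, where $n_J,n_H,n_G$ are the numbers of Jacobian-vector products, Hessian-vector products and gradient evaluations made in its $K$ outer iterations and $t>0$ is a universal constant. **Theorem.** $\Phi$ is differentiable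 with $L_\Phi$-Lipschitz gradient. Let $D>0$ be an arbitrary constant. There are polynomials $P_1,P_2$ with coefficients depending only on $L_x,L_{xy},L_y,\widetilde L_{xy},\rho_{xy},\rho_{yy},t,c,D$, and a constant $C>0$ depending only on these quantities and on $U$, such that whenever $\mu_y\le D$ and $0<\varepsilon\le D$, the numbers $N,M,K$ can be chosen so that AccBiO-BG reaches $\Phi(z_K)-\Phi(x^*)\le\varepsilon$ with complexity $$\mathcal C\le C\sqrt{\frac{\widetilde L_y}{\mu_x\mu_y^4}}\;\log\frac{P_1\big(\mu_x^{\pm1},\mu_y^{\pm1},\widetilde L_y,U,\Delta,r\big)}{\varepsilon}\;\log\frac{P_2\big(\mu_x^{\pm1},\mu_y^{\pm1},\widetilde L_y,U\big)}{\varepsilon},$$ where $\Delta\ge\Phi(0)-\Phi(x^*)$ and $r\ge\|y^*(0)\|$ are any upper bounds, and the values of $P_1,P_2$ exceed $\varepsilon$. The choice is uniform over the problem class: $N,M$ depend only on $\widetilde L_y,\mu_x,\mu_y,U,\varepsilon,\alpha$ and the constants above, and $K$ only on these and on $\Delta,r$ (in particular not on $p$, $q$, $f$, $g$ otherwise). 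-/

import Mathlib

noncomputable section

namespace Bilevel

/-- `ℝⁿ` with the Euclidean norm. -/
abbrev E (n : ℕ) : Type := EuclideanSpace ℝ (Fin n)

variable {p q : ℕ}

/-- The partial gradient `∇ₓ f(x, y) ∈ ℝᵖ`. -/
def gradX (f : E p → E q → ℝ) (x : E p) (y : E q) : E p :=
  gradient (fun x' => f x' y) x

/-- The partial gradient `∇_y f(x, y) ∈ ℝ^q`. -/
def gradY (f : E p → E q → ℝ) (x : E p) (y : E q) : E q :=
  gradient (f x) y

/-- The Hessian `∇²_y g(x, y) ∈ ℝ^{q × q}`, as a linear map. -/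
def hessY (g : E p → E q → ℝ) (x : E p) (y : E q) : E q →L[ℝ] E q :=
  fderiv ℝ (gradY g x) y

/-- The mixed derivative `∇ₓ∇_y g(x, y) ∈ ℝ^{p × q}`, as a linear map `ℝ^q → ℝᵖ`: its `(i, j)` entry
is `∂²g / ∂xᵢ∂yⱼ`, i.e. it is the transpose of the derivative of `x ↦ ∇_y g(x, y)`. -/
def jacXY (g : E p → E q → ℝ) (x : E p) (y : E q) : E q →L[ℝ] E p :=
  ContinuousLinearMap.adjoint (fderiv ℝ (fun x' => gradY g x' y) x)

/-- The lower-level solution `y*(x) = argmin_y g(x, y)` (a minimizer whenever there is one; under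
strong convexity of `g(x, ·)` it is the unique one). -/
def lowerSol (g : E p → E q → ℝ) (x : E p) : E q :=
  Classical.epsilon fun y => IsMinOn (g x) Set.univ y

/-- The bilevel objective `Φ(x) = f(x, y*(x))`. -/
def objective (f g : E p → E q → ℝ) (x : E p) : ℝ :=
  f x (lowerSol g x)

/-- The strongly-convex–strongly-convex class of bilevel problems. The constants `Lx, Lxy, Ly` are
the smoothness constants of `f`; `Lgxy, Lgy` (written `L̃_{xy}, L̃_y` in the text) are those of `g`;
`ρxy, ρyy` are the Lipschitz constants of `∇ₓ∇_y g` and `∇²_y g` with respect to the Euclidean norm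
of `(x, y)`. -/
structure IsSCSC (Lx Lxy Ly Lgxy Lgy ρxy ρyy μx μy : ℝ) (f g : E p → E q → ℝ) : Prop where
  f_contDiff : ContDiff ℝ 1 fun w : E p × E q => f w.1 w.2
  g_contDiff : ContDiff ℝ 1 fun w : E p × E q => g w.1 w.2
  gradY_g_contDiff : ContDiff ℝ 1 fun w : E p × E q => gradY g w.1 w.2
  gradX_f_lip_x : ∀ x₁ x₂ y, ‖gradX f x₁ y - gradX f x₂ y‖ ≤ Lx * ‖x₁ - x₂‖
  gradX_f_lip_y : ∀ x y₁ y₂, ‖gradX f x y₁ - gradX f x y₂‖ ≤ Lxy * ‖y₁ - y₂‖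
  gradY_f_lip_x : ∀ x₁ x₂ y, ‖gradY f x₁ y - gradY f x₂ y‖ ≤ Lxy * ‖x₁ - x₂‖
  gradY_f_lip_y : ∀ x y₁ y₂, ‖gradY f x y₁ - gradY f x y₂‖ ≤ Ly * ‖y₁ - y₂‖
  gradY_g_lip_x : ∀ x₁ x₂ y, ‖gradY g x₁ y - gradY g x₂ y‖ ≤ Lgxy * ‖x₁ - x₂‖
  gradY_g_lip_y : ∀ x y₁ y₂, ‖gradY g x y₁ - gradY g x y₂‖ ≤ Lgy * ‖y₁ - y₂‖
  jacXY_g_lip : ∀ x₁ y₁ x₂ y₂,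
    ‖jacXY g x₁ y₁ - jacXY g x₂ y₂‖ ≤ ρxy * √(‖x₁ - x₂‖ ^ 2 + ‖y₁ - y₂‖ ^ 2)
  hessY_g_lip : ∀ x₁ y₁ x₂ y₂,
    ‖hessY g x₁ y₁ - hessY g x₂ y₂‖ ≤ ρyy * √(‖x₁ - x₂‖ ^ 2 + ‖y₁ - y₂‖ ^ 2)
  g_strongConvex : ∀ x, StrongConvexOn Set.univ μy (g x)
  objective_strongConvex : StrongConvexOn Set.univ μx (objective f g)
  exists_min : ∃ xs : E p, IsMinOn (objective f g) Set.univ xs ∧ ∃ B : ℝ, 0 < B ∧ ‖xs‖ = B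

/-- The smoothness parameter `L_Φ` of `Φ` when `‖∇_y f‖ ≤ U`. -/
def smoothPhi (Lx Lxy Ly Lgxy ρxy ρyy U μy : ℝ) : ℝ :=
  Lx + 2 * Lxy * Lgxy / μy
    + (U * ρxy / μy + U * Lgxy * ρyy / μy ^ 2) * (1 + Lgxy / μy)
    + Lgxy ^ 2 * Ly / μy ^ 2

/-! ### The algorithm, with counters for the oracle calls -/

/-- State of the inner accelerated gradient loop: the iterates `yᵗ, sᵗ` and the number of
evaluations of `∇_y g` made so far. -/
structure AGDState (q : ℕ) where
  y : E q
  s : E q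
  nG : ℕ

/-- One step of accelerated gradient descent for a function with gradient `dg`:
`yᵗ = sᵗ⁻¹ - dg(sᵗ⁻¹) / L`, `sᵗ = 2√κ/(√κ+1) yᵗ - (√κ-1)/(√κ+1) yᵗ⁻¹`. -/
def agdStep (L κ : ℝ) (dg : E q → E q) (S : AGDState q) : AGDState q :=
  let y' := S.s - (1 / L) • dg S.s
  { y := y'
    s := (2 * √κ / (√κ + 1)) • y' - ((√κ - 1) / (√κ + 1)) • S.y
    nG := S.nG + 1 }

/-- State of the heavy-ball loop: `vᵗ`, `vᵗ⁻¹` and the number of Hessian-vector products so far. -/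
structure HBState (q : ℕ) where
  v : E q
  vPrev : E q
  nH : ℕ

/-- One heavy-ball step `vᵗ⁺¹ = vᵗ - lam ∇Q(vᵗ) + θ (vᵗ - vᵗ⁻¹)` for
`Q(v) = ½ vᵀ H v - vᵀ b`, so `∇Q(v) = H v - b`. -/
def hbStep (lam θ : ℝ) (H : E q →L[ℝ] E q) (b : E q) (S : HBState q) : HBState q :=
  { v := S.v - lam • (H S.v - b) + θ • (S.v - S.vPrev)
    vPrev := S.v
    nH := S.nH + 1 }

/-- Parameters of the algorithm: `L, κ` are the ones of the inner loop, `lam, θ` the ones of the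
heavy-ball method, `η, τ, α, β` the ones of the outer updates, `N` and `M` the lengths of the two
inner loops. -/
structure Params where
  L : ℝ
  κ : ℝ
  lam : ℝ
  θ : ℝ
  η : ℕ → ℝ
  τ : ℕ → ℝ
  α : ℕ → ℝ
  β : ℕ → ℝ
  N : ℕ
  M : ℕ

/-- State of the outer loop after `k` iterations: `x_k`, `z_k`, the warm start `y_k⁰ = y_{k-1}ᴺ`
(`0` for `k = 0`), and the numbers of gradient evaluations, Jacobian-vector products and
Hessian-vector products made so far. -/
structure State (p q : ℕ) where
  x : E p
  z : E p
  y : E q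
  nG : ℕ
  nJ : ℕ
  nH : ℕ

/-- Iteration `k` of AccBiO-BG. The heavy-ball loop starts from `v⁰ = v¹ = 0`, so `v^M` is reached
after `M - 1` further updates. Besides those of the inner loop, the gradients `∇ₓ f` and `∇_y f` are
evaluated once each. -/
def accBiOBGStep (P : Params) (f g : E p → E q → ℝ) (k : ℕ) (S : State p q) : State p q :=
  let xt := P.η k • S.x + (1 - P.η k) • S.z
  let inner := (agdStep P.L P.κ (gradY g xt))^[P.N] { y := S.y, s := S.y, nG := 0 }
  let yN := inner.y
  let hb := (hbStep P.lam P.θ (hessY g xt yN) (gradY f xt yN))^[P.M - 1]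
    { v := 0, vPrev := 0, nH := 0 }
  let G := gradX f xt yN - jacXY g xt yN hb.v
  { x := P.τ k • xt + (1 - P.τ k) • S.x - P.β k • G
    z := xt - P.α k • G
    y := yN
    nG := S.nG + inner.nG + 2
    nJ := S.nJ + 1
    nH := S.nH + hb.nH }

/-- AccBiO-BG started from `x₀ = z₀ = 0`, `y₀ = 0`: the state after `k` outer iterations. -/
def accBiOBG (P : Params) (f g : E p → E q → ℝ) : ℕ → State p q
  | 0 => { x := 0, z := 0, y := 0, nG := 0, nJ := 0, nH := 0 }
  | k + 1 => accBiOBGStep P f g k (accBiOBG P f g k)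

/-- The complexity `t (n_J + n_H) + n_G`, where `t` is the relative cost of a Jacobian- or
Hessian-vector product. -/
def State.complexity (t : ℝ) (S : State p q) : ℝ :=
  t * ((S.nJ : ℝ) + S.nH) + S.nG

/-- The parameter choice for the strongly-convex–strongly-convex class with outer stepsize `α`. -/
def scscParams (Lgy μx μy α : ℝ) (N M : ℕ) : Params :=
  let lam := 4 / (√Lgy + √μy) ^ 2
  { L := Lgy
    κ := Lgy / μy
    lam := lam
    θ := max ((1 - √(lam * μy)) ^ 2) ((1 - √(lam * Lgy)) ^ 2)
    η := fun _ => √(α * μx) / (√(α * μx) + 2)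
    τ := fun _ => √(α * μx) / 2
    α := fun _ => α
    β := fun _ => √(α / μx)
    N := N
    M := M }

end Bilevel

end

/-! The outer loop is Nesterov's method for the strongly convex smooth function `Φ`, run with an
inexact gradient `G`. The exact gradient is `∇ₓf - ∇ₓ∇_y g · v` at `(x, y*(x))`, where `∇²_y g · v =
∇_y f` (`hasGradientAt_objective`). `G` misses it by at most `c₁ ‖y_k^N - y*(x̃_k)‖ + e`, where `e`
comes from the heavy-ball loop (`hypergradient_error`). Both inner loops converge linearly
(`agd_dist_sq_le`, `hb_norm_sub_le`).

The difficulty is the warm start: its distance to `y*(x̃_k)` depends on the outer iterates, and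
these are not known to be bounded in advance. A joint Lyapunov function resolves it: `W = Φ(z) -
Φ(x*) + μx/4 ‖x - x*‖² + A ‖y - y*(x*)‖²`. Only half of the strong convexity is spent on
contraction, so each outer step leaves a spare term `-τμx/8 ‖x̃ - x*‖²` (`outer_lyapunov_step`).
Since `y*` is Lipschitz, this term pays for replacing `y*(x̃)` by `y*(x*)` when `A` is small
(`coupled_lyapunov_step`). Then `W` contracts by `1 - τ/2` up to `2 c₂ e²`, provided the inner loop
contracts by a factor independent of `ε`.

For the cost, `K` is of order `(α μx)^(-1/2)` and `N`, `M` of order `√κ_y`, each times a logarithm.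
Since `1/α ≤ L_Φ / c` and `L_Φ μy³` is bounded for `μy ≤ D`, the product is of order `√(L̃_y / (μx
μy⁴))`. The arguments of the logarithms are polynomial because every quantity involved is bounded by
a power of `1 + μx + 1/μx + μy + 1/μy + L̃_y + U` (`exists_bound`). -/

noncomputable section
namespace Bilevel
open Filter Topology

/-! ### Convexity inequalities and one accelerated step with an inexact gradient. -/

section Generic
variable {F : Type*} [NormedAddCommGroup F] [InnerProductSpace ℝ F]

theorem hasDerivAt_comp_segment [CompleteSpace F] {φ : F → ℝ} {d x v : F} {s : ℝ}
    (h : HasGradientAt φ d (x + s • v)) :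
    HasDerivAt (fun t : ℝ => φ (x + t • v)) (inner ℝ d v) s := by
  have h1 : HasDerivAt (fun t : ℝ => x + t • v) v s := by
    simpa using ((hasDerivAt_id s).smul_const v).const_add x
  have h2 := h.hasFDerivAt.comp_hasDerivAt s h1
  rw [InnerProductSpace.toDual_apply_apply] at h2
  exact h2

/-- First-order lower bound for a strongly convex function. -/
theorem strongConvexOn_gradient_le [CompleteSpace F] {φ : F → ℝ} {μ : ℝ} {d x : F}
    (hφ : StrongConvexOn Set.univ μ φ) (hd : HasGradientAt φ d x) (y : F) :
    φ x + inner ℝ d (y - x) + μ / 2 * ‖y - x‖ ^ 2 ≤ φ y := by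
  have h1 : HasDerivAt (fun t : ℝ => φ (x + t • (y - x))) (inner ℝ d (y - x)) 0 :=
    hasDerivAt_comp_segment (by simpa using hd)
  have h2 := h1.tendsto_slope_zero_right
  have h3 : Tendsto (fun t : ℝ => φ y - φ x - (1 - t) * (μ / 2 * ‖y - x‖ ^ 2)) (𝓝[>] 0)
      (𝓝 (φ y - φ x - (1 - 0) * (μ / 2 * ‖y - x‖ ^ 2))) := by
    apply tendsto_nhdsWithin_of_tendsto_nhds
    apply Continuous.tendsto
    fun_prop
  have h4 : inner ℝ d (y - x) ≤ φ y - φ x - (1 - 0) * (μ / 2 * ‖y - x‖ ^ 2) := by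
    refine le_of_tendsto_of_tendsto h2 h3 ?_
    have : Set.Ioo (0 : ℝ) 1 ∈ 𝓝[>] (0 : ℝ) := Ioo_mem_nhdsGT one_pos
    filter_upwards [this] with t ht
    have h5 := hφ.2 (Set.mem_univ x) (Set.mem_univ y)
      (sub_nonneg.2 ht.2.le) ht.1.le (sub_add_cancel 1 t)
    have h6 : ((1 : ℝ) - t) • x + t • y = x + t • (y - x) := by module
    rw [h6, norm_sub_rev] at h5
    simp only [smul_eq_mul] at h5 ⊢
    simp only [zero_add, zero_smul, add_zero]
    rw [inv_mul_le_iff₀ ht.1]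
    linarith
  linarith

/-- The descent lemma. -/
theorem le_of_lipschitz_gradient [CompleteSpace F] {φ : F → ℝ} {L : ℝ} {d : F → F}
    (hd : ∀ x, HasGradientAt φ (d x) x) (hL : ∀ x y, ‖d x - d y‖ ≤ L * ‖x - y‖) (x y : F) :
    φ y ≤ φ x + inner ℝ (d x) (y - x) + L / 2 * ‖y - x‖ ^ 2 := by
  set v := y - x with hv
  have h1 : ∀ s : ℝ, HasDerivAt (fun t : ℝ => φ (x + t • v) - t * inner ℝ (d x) v
      - t ^ 2 * (L / 2 * ‖v‖ ^ 2)) (inner ℝ (d (x + s • v)) v - inner ℝ (d x) v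
      - 2 * s * (L / 2 * ‖v‖ ^ 2)) s := by
    intro s
    have a := hasDerivAt_comp_segment (v := v) (hd (x + s • v))
    have b := (hasDerivAt_id s).mul_const (inner ℝ (d x) v)
    have c := (hasDerivAt_pow 2 s).mul_const (L / 2 * ‖v‖ ^ 2)
    have e := (a.sub b).sub c
    simp only [id, one_mul, Nat.cast_ofNat, Nat.reduceSub, pow_one] at e
    exact e
  have h2 : AntitoneOn (fun t : ℝ => φ (x + t • v) - t * inner ℝ (d x) v
      - t ^ 2 * (L / 2 * ‖v‖ ^ 2)) (Set.Icc 0 1) := by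
    apply antitoneOn_of_deriv_nonpos (convex_Icc 0 1)
    · exact fun s _ => (h1 s).continuousAt.continuousWithinAt
    · exact fun s _ => (h1 s).differentiableAt.differentiableWithinAt
    · intro s hs
      rw [interior_Icc] at hs
      rw [(h1 s).deriv, ← inner_sub_left]
      have a := real_inner_le_norm (d (x + s • v) - d x) v
      have b := hL (x + s • v) x
      rw [add_sub_cancel_left, norm_smul, Real.norm_of_nonneg hs.1.le] at b
      nlinarith [norm_nonneg v]
  have h3 := h2 (Set.left_mem_Icc.2 zero_le_one) (Set.right_mem_Icc.2 zero_le_one) zero_le_one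
  simp [hv] at h3
  linarith

/-- One step of an accelerated gradient method with an inexact gradient `G` in place of `d`. -/
theorem accel_step {x z xt xs G d : F} {τ β w μ fxt fz fs : ℝ} (hτ0 : 0 ≤ τ) (hτ1 : τ ≤ 1)
    (hw : w * β = τ) (hxt : τ • (x - xt) = xt - z)
    (hz : fxt + inner ℝ d (z - xt) ≤ fz)
    (hs : fxt + inner ℝ d (xs - xt) + μ / 2 * ‖xs - xt‖ ^ 2 ≤ fs) :
    fxt - fs + w / 2 * ‖τ • xt + (1 - τ) • x - β • G - xs‖ ^ 2
      ≤ (1 - τ) * (fz - fs + w / 2 * ‖x - xs‖ ^ 2) + τ * β / 2 * ‖G‖ ^ 2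
        - τ * inner ℝ (G - d) ((1 - τ) • (x - xs) + τ • (xt - xs))
        + (w - μ) / 2 * τ * ‖xt - xs‖ ^ 2 - w / 2 * (1 - τ) * τ * ‖x - xt‖ ^ 2 := by
  obtain ⟨a, rfl⟩ : ∃ a, x = xt + a := ⟨x - xt, by abel⟩
  obtain ⟨b, rfl⟩ : ∃ b, xs = xt + b := ⟨xs - xt, by abel⟩
  obtain rfl : z = xt - τ • a := by
    rw [add_sub_cancel_left] at hxt; rw [hxt]; abel
  have e1 : τ • xt + (1 - τ) • (xt + a) - β • G - (xt + b) = (1 - τ) • a - b - β • G := by module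
  have e2 : (1 - τ) • (xt + a - (xt + b)) + τ • (xt - (xt + b)) = (1 - τ) • a - b := by module
  have e3 : xt - τ • a - xt = -(τ • a) := by abel
  have e4 : xt + a - (xt + b) = a - b := by abel
  have e5 : xt - (xt + b) = - b := by abel
  rw [e1, e2, e4, e5, norm_neg, add_sub_cancel_left]
  rw [e3, inner_neg_right, inner_smul_right] at hz
  rw [add_sub_cancel_left] at hs
  have n1 : ‖(1 - τ) • a - b - β • G‖ ^ 2 = ‖(1 - τ) • a - b‖ ^ 2
      - 2 * β * inner ℝ G ((1 - τ) • a - b) + β ^ 2 * ‖G‖ ^ 2 := by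
    rw [norm_sub_sq_real, inner_smul_right, norm_smul, mul_pow, Real.norm_eq_abs, sq_abs,
      real_inner_comm]
    ring
  have n2 : ‖(1 - τ) • a - b‖ ^ 2 = (1 - τ) * ‖a - b‖ ^ 2 + τ * ‖b‖ ^ 2
      - (1 - τ) * τ * ‖a‖ ^ 2 := by
    rw [norm_sub_sq_real, norm_sub_sq_real, norm_smul, mul_pow, Real.norm_eq_abs, sq_abs,
      real_inner_smul_left]
    ring
  have n3 : inner ℝ (G - d) ((1 - τ) • a - b) = inner ℝ G ((1 - τ) • a - b)
      - (1 - τ) * inner ℝ d a + inner ℝ d b := by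
    rw [inner_sub_left, inner_sub_right (x := d), inner_smul_right]
    ring
  rw [n1, n2, n3]
  -- With weights `1 - τ` and `τ` the inner products with `d` cancel against those in `n3`, so `d`
  -- survives only through `G - d`.
  have k1 := mul_le_mul_of_nonneg_left hz (sub_nonneg.2 hτ1)
  have k2 := mul_le_mul_of_nonneg_left hs hτ0
  subst hw
  linarith

end Generic
end Bilevel
end

noncomputable section
namespace Bilevel
open Filter Topology

/-! ### Nesterov's method for the lower-level problem. -/

section AGD
variable {q : ℕ}

/-- The auxiliary sequence in the analysis of Nesterov's method. -/
def agdAux (κ : ℝ) (S : AGDState q) : E q := S.s + √κ • (S.s - S.y)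

theorem agdStep_lyapunov {φ : E q → ℝ} {d : E q → E q} {L μ : ℝ} (hμ : 0 < μ) (hμL : μ ≤ L)
    (hsc : ∀ x y, φ x + inner ℝ (d x) (y - x) + μ / 2 * ‖y - x‖ ^ 2 ≤ φ y)
    (hsm : ∀ x y, φ y ≤ φ x + inner ℝ (d x) (y - x) + L / 2 * ‖y - x‖ ^ 2)
    (ys : E q) (S : AGDState q) :
    φ (agdStep L (L / μ) d S).y - φ ys
        + μ / 2 * ‖agdAux (L / μ) (agdStep L (L / μ) d S) - ys‖ ^ 2
      ≤ (1 - 1 / √(L / μ)) * (φ S.y - φ ys + μ / 2 * ‖agdAux (L / μ) S - ys‖ ^ 2) := by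
  have hL : 0 < L := hμ.trans_le hμL
  have hk2 : √(L / μ) ^ 2 = L / μ := Real.sq_sqrt (by positivity)
  have hk1 : 1 ≤ √(L / μ) := Real.one_le_sqrt.2 ((one_le_div hμ).2 hμL)
  set k := √(L / μ) with hk
  have hk0 : 0 < k := by linarith
  have hLk : L = k ^ 2 * μ := by rw [hk2]; field_simp
  -- Exact gradient, `τ = 1/√κ` and the full weight `w = μ`. The auxiliary point is the one for
  -- which `s` is the required combination of it and `y`.
  have key := accel_step (x := agdAux (L / μ) S) (z := S.y) (xt := S.s) (xs := ys) (G := d S.s)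
    (d := d S.s) (τ := 1 / k) (β := 1 / (k * μ)) (w := μ) (μ := μ) (fxt := φ S.s) (fz := φ S.y)
    (fs := φ ys) (by positivity) ((div_le_one hk0).2 hk1) (by field_simp)
    (by
      rw [agdAux, ← hk]
      match_scalars <;> field_simp
      ring)
    (by have := hsc S.s S.y; have : 0 ≤ μ / 2 * ‖S.y - S.s‖ ^ 2 := by positivity
        linarith)
    (hsc _ _)
  have e1 : agdAux (L / μ) (agdStep L (L / μ) d S)
      = (1 / k) • S.s + (1 - 1 / k) • agdAux (L / μ) S - (1 / (k * μ)) • d S.s := by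
    simp only [agdAux, agdStep, ← hk]
    rw [hLk]
    match_scalars <;> field_simp <;> ring
  have e2 : φ (agdStep L (L / μ) d S).y ≤ φ S.s - 1 / (2 * L) * ‖d S.s‖ ^ 2 := by
    have := hsm S.s (agdStep L (L / μ) d S).y
    have e3 : (agdStep L (L / μ) d S).y - S.s = -((1 / L) • d S.s) := by
      simp only [agdStep]; abel
    rw [e3, inner_neg_right, inner_smul_right, real_inner_self_eq_norm_sq, norm_neg, norm_smul,
      mul_pow, Real.norm_eq_abs, sq_abs] at this
    refine this.trans (le_of_eq ?_)
    field_simp; ring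
  rw [sub_self, inner_zero_left, ← e1] at key
  -- The term `τβ/2 ‖G‖²` is exactly the decrease `1/(2L) ‖d‖²` of the gradient step.
  have e4 : 1 / k * (1 / (k * μ)) / 2 = 1 / (2 * L) := by rw [hLk]; field_simp
  rw [e4] at key
  have e5 : 0 ≤ μ / 2 * (1 - 1 / k) * (1 / k) * ‖agdAux (L / μ) S - S.s‖ ^ 2 := by
    have : 0 ≤ 1 - 1 / k := sub_nonneg.2 ((div_le_one hk0).2 hk1)
    positivity
  linarith

theorem agd_nG (L κ : ℝ) (d : E q → E q) (N : ℕ) (S : AGDState q) :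
    ((agdStep L κ d)^[N] S).nG = S.nG + N := by
  induction N with
  | zero => rfl
  | succ n ih => rw [Function.iterate_succ_apply', agdStep, ih]; rfl

/-- Linear convergence of Nesterov's method for a smooth strongly convex function. -/
theorem agd_dist_sq_le {φ : E q → ℝ} {d : E q → E q} {L μ : ℝ} (hμ : 0 < μ) (hμL : μ ≤ L)
    (hsc : ∀ x y, φ x + inner ℝ (d x) (y - x) + μ / 2 * ‖y - x‖ ^ 2 ≤ φ y)
    (hsm : ∀ x y, φ y ≤ φ x + inner ℝ (d x) (y - x) + L / 2 * ‖y - x‖ ^ 2)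
    {ys : E q} (hys : d ys = 0) (y₀ : E q) (N : ℕ) :
    ‖((agdStep L (L / μ) d)^[N] ⟨y₀, y₀, 0⟩).y - ys‖ ^ 2
      ≤ (L / μ + 1) * (1 - 1 / √(L / μ)) ^ N * ‖y₀ - ys‖ ^ 2 := by
  have hk1 : 1 ≤ √(L / μ) := Real.one_le_sqrt.2 ((one_le_div hμ).2 hμL)
  have hr : 0 ≤ 1 - 1 / √(L / μ) :=
    sub_nonneg.2 ((div_le_one (by linarith)).2 hk1)
  have h1 : ∀ n : ℕ, φ ((agdStep L (L / μ) d)^[n] ⟨y₀, y₀, 0⟩).y - φ ys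
        + μ / 2 * ‖agdAux (L / μ) ((agdStep L (L / μ) d)^[n] ⟨y₀, y₀, 0⟩) - ys‖ ^ 2
      ≤ (1 - 1 / √(L / μ)) ^ n * (φ y₀ - φ ys + μ / 2 * ‖y₀ - ys‖ ^ 2) := by
    intro n
    induction n with
    | zero => simp [agdAux]
    | succ n ih =>
      rw [Function.iterate_succ_apply']
      refine (agdStep_lyapunov hμ hμL hsc hsm ys _).trans ?_
      rw [pow_succ' (1 - 1 / √(L / μ)), mul_assoc]
      exact mul_le_mul_of_nonneg_left ih hr
  have h2 := hsc ys ((agdStep L (L / μ) d)^[N] ⟨y₀, y₀, 0⟩).y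
  have h3 := hsm ys y₀
  rw [hys, inner_zero_left] at h2 h3
  have h4 := h1 N
  set yN := ((agdStep L (L / μ) d)^[N] ⟨y₀, y₀, 0⟩).y
  have h5 : 0 ≤ μ / 2 * ‖agdAux (L / μ) ((agdStep L (L / μ) d)^[N] ⟨y₀, y₀, 0⟩) - ys‖ ^ 2 := by
    positivity
  have h6 : (1 - 1 / √(L / μ)) ^ N * (φ y₀ - φ ys + μ / 2 * ‖y₀ - ys‖ ^ 2)
      ≤ (1 - 1 / √(L / μ)) ^ N * ((L + μ) / 2 * ‖y₀ - ys‖ ^ 2) :=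
    mul_le_mul_of_nonneg_left (by linarith) (by positivity)
  have h7 : μ / 2 * ‖yN - ys‖ ^ 2
      ≤ (1 - 1 / √(L / μ)) ^ N * ((L + μ) / 2 * ‖y₀ - ys‖ ^ 2) := by linarith
  have h8 : (L / μ + 1) * (1 - 1 / √(L / μ)) ^ N * ‖y₀ - ys‖ ^ 2
      = 2 / μ * ((1 - 1 / √(L / μ)) ^ N * ((L + μ) / 2 * ‖y₀ - ys‖ ^ 2)) := by
    field_simp
  rw [h8]
  calc ‖yN - ys‖ ^ 2 = 2 / μ * (μ / 2 * ‖yN - ys‖ ^ 2) := by field_simp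
    _ ≤ _ := mul_le_mul_of_nonneg_left h7 (by positivity)

end AGD

/-! ### The heavy-ball method for a quadratic, by an energy argument. -/

section HeavyBall

/-- For a symmetric operator the quadratic form controls the norm: polarize `⟪A u, v⟫` with `v` the
multiple of `A u` that has the length of `u`, and apply the parallelogram law. -/
theorem norm_apply_le_of_abs_inner_le {F : Type*} [NormedAddCommGroup F] [InnerProductSpace ℝ F]
    {A : F →ₗ[ℝ] F} (hA : ∀ u v, inner ℝ (A u) v = inner ℝ u (A v)) {c : ℝ}
    (hc : ∀ u, |inner ℝ (A u) u| ≤ c * ‖u‖ ^ 2) (u : F) : ‖A u‖ ≤ c * ‖u‖ := by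
  rcases eq_or_ne u 0 with rfl | hu
  · simp
  rcases eq_or_ne (A u) 0 with h0 | h0
  · have := hc u
    rw [h0, inner_zero_left, abs_zero] at this
    rw [h0, norm_zero]
    have hu' : 0 < ‖u‖ := norm_pos_iff.2 hu
    by_contra! h
    nlinarith
  have hu' : 0 < ‖u‖ := norm_pos_iff.2 hu
  have h0' : 0 < ‖A u‖ := norm_pos_iff.2 h0
  set s := ‖u‖ / ‖A u‖ with hs
  set v := s • A u with hv
  have hvn : ‖v‖ = ‖u‖ := by
    rw [hv, norm_smul, Real.norm_of_nonneg (by positivity), hs]; field_simp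
  have h1 : 4 * inner ℝ (A u) v = inner ℝ (A (u + v)) (u + v) - inner ℝ (A (u - v)) (u - v) := by
    simp only [map_add, map_sub, inner_add_left, inner_add_right, inner_sub_left, inner_sub_right]
    rw [hA v u, real_inner_comm]
    ring
  have h2 := (abs_le.1 (hc (u + v))).2
  have h3 := (abs_le.1 (hc (u - v))).1
  have h4 := parallelogram_law_with_norm ℝ u v
  have h5 : inner ℝ (A u) v = ‖u‖ * ‖A u‖ := by
    rw [hv, inner_smul_right, real_inner_self_eq_norm_sq, hs]; field_simp
  rw [hvn] at h4
  have h6 : ‖u‖ * ‖A u‖ ≤ ‖u‖ * (c * ‖u‖) := by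
    have h7 : c * (‖u + v‖ ^ 2 + ‖u - v‖ ^ 2) = c * (2 * (‖u‖ ^ 2 + ‖u‖ ^ 2)) := by rw [h4]
    linarith
  exact le_of_mul_le_mul_left h6 hu'

variable {q : ℕ}

theorem hb_nH (lam θ : ℝ) (H : E q →L[ℝ] E q) (b : E q) (n : ℕ) (S : HBState q) :
    ((hbStep lam θ H b)^[n] S).nH = S.nH + n := by
  induction n with
  | zero => rfl
  | succ n ih => rw [Function.iterate_succ_apply', hbStep, ih]; rfl

/-- The error obeys `e⁺ = A e - r² p` with `A = (1 + r²) I - lam H` and `p` the previous error. A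
quadratic energy is multiplied by exactly `r²` at each step, so no diagonalization is needed. The
factor `2n + 1` is the price of the double root at the ends of the spectrum. -/
theorem hb_norm_sub_le_aux {lam r : ℝ} {H : E q →L[ℝ] E q} (hr0 : 0 ≤ r) (hr1 : r ≤ 1)
    (hH : ∀ u v, inner ℝ (H u) v = inner ℝ u (H v))
    (hA : ∀ u, ‖(1 + r ^ 2) • u - lam • H u‖ ≤ 2 * r * ‖u‖) (vs : E q) (n : ℕ) :
    ‖((hbStep lam (r ^ 2) H (H vs))^[n] ⟨0, 0, 0⟩).v - vs‖ ≤ (2 * n + 1) * r ^ n * ‖vs‖ := by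
  let A : E q →ₗ[ℝ] E q := (1 + r ^ 2) • LinearMap.id - lam • (H : E q →ₗ[ℝ] E q)
  have hA1 : ∀ u, A u = (1 + r ^ 2) • u - lam • H u := fun u => rfl
  have hA2 : ∀ u, ‖A u‖ ≤ 2 * r * ‖u‖ := hA
  have hAs : ∀ u v, inner ℝ (A u) v = inner ℝ u (A v) := by
    intro u v
    simp only [hA1, inner_sub_left, inner_sub_right, real_inner_smul_left, inner_smul_right, hH]
  let en : E q → E q → ℝ := fun e p => ‖e‖ ^ 2 - inner ℝ e (A p) + r ^ 2 * ‖p‖ ^ 2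
  have en_step : ∀ e p, en (A e - r ^ 2 • p) e = r ^ 2 * en e p := by
    intro e p
    simp only [en]
    have h1 : inner ℝ (A e - r ^ 2 • p) (A e)
        = ‖A e - r ^ 2 • p‖ ^ 2 + r ^ 2 * inner ℝ (A e - r ^ 2 • p) p := by
      rw [← real_inner_self_eq_norm_sq, ← inner_smul_right, ← inner_add_right, sub_add_cancel]
    rw [h1, inner_sub_left, real_inner_smul_left, real_inner_self_eq_norm_sq, hAs e p]
    ring
  have en_bound : ∀ e p s, 0 ≤ s → en e p ≤ s ^ 2 → ‖e‖ ≤ r * ‖p‖ + s := by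
    intro e p s hs h
    -- Completing the square: the left side is `en e p + ‖A p‖²/4 - r² ‖p‖²`, and `‖A p‖ ≤ 2 r ‖p‖`.
    have h1 : ‖e - (1 / 2 : ℝ) • A p‖ ^ 2 ≤ s ^ 2 := by
      rw [norm_sub_sq_real, inner_smul_right, norm_smul, mul_pow, Real.norm_of_nonneg (by norm_num)]
      have h2 : ‖A p‖ ^ 2 ≤ (2 * r * ‖p‖) ^ 2 := by gcongr; exact hA2 p
      simp only [en] at h
      nlinarith
    have h2 := abs_le_of_sq_le_sq h1 hs
    rw [abs_of_nonneg (norm_nonneg _)] at h2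
    have h3 : ‖(1 / 2 : ℝ) • A p‖ ≤ r * ‖p‖ := by
      rw [norm_smul, Real.norm_of_nonneg (by norm_num)]
      linarith [hA2 p]
    calc ‖e‖ = ‖(e - (1 / 2 : ℝ) • A p) + (1 / 2 : ℝ) • A p‖ := by rw [sub_add_cancel]
      _ ≤ _ := norm_add_le _ _
      _ ≤ _ := by linarith
  set S : ℕ → HBState q := fun n => (hbStep lam (r ^ 2) H (H vs))^[n] ⟨0, 0, 0⟩ with hS
  have S_succ : ∀ n, S (n + 1) = hbStep lam (r ^ 2) H (H vs) (S n) := fun n =>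
    Function.iterate_succ_apply' _ _ _
  have Sp : ∀ n, (S (n + 1)).vPrev = (S n).v := fun n => by rw [S_succ]; rfl
  have Sv : ∀ n, (S (n + 1)).v - vs
      = A ((S n).v - vs) - r ^ 2 • ((S n).vPrev - vs) := fun n => by
    rw [S_succ, hA1, hbStep, map_sub]
    module
  have hen : ∀ n, en ((S n).v - vs) ((S n).vPrev - vs) ≤ (r ^ n * (2 * ‖vs‖)) ^ 2 := by
    intro n
    induction n with
    | zero =>
      simp only [hS, Function.iterate_zero, id, en, zero_sub, norm_neg, map_neg, inner_neg_neg]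
      have h1 := abs_le.1 (abs_real_inner_le_norm vs (A vs))
      have h2 := hA2 vs
      have h3 := norm_nonneg vs
      have h4 : ‖vs‖ * ‖A vs‖ ≤ 2 * ‖vs‖ ^ 2 := by nlinarith
      have h5 : r ^ 2 ≤ 1 := pow_le_one₀ hr0 hr1
      nlinarith
    | succ n ih =>
      rw [Sp, Sv, en_step]
      calc r ^ 2 * _ ≤ r ^ 2 * (r ^ n * (2 * ‖vs‖)) ^ 2 := by gcongr
        _ = _ := by ring
  change ‖(S n).v - vs‖ ≤ _
  induction n with
  | zero => simp [hS]
  | succ n ih =>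
    have h1 := en_bound _ _ _ (by positivity) (hen (n + 1))
    rw [Sp] at h1
    refine h1.trans ?_
    calc _ ≤ r * ((2 * n + 1) * r ^ n * ‖vs‖) + r ^ (n + 1) * (2 * ‖vs‖) := by gcongr
      _ = _ := by push_cast; ring

/-- Linear convergence of the heavy-ball method for a strongly convex quadratic. -/
theorem hb_norm_sub_le {L μ : ℝ} (hμ : 0 < μ) (hμL : μ ≤ L) {H : E q →L[ℝ] E q}
    (hH : ∀ u v, inner ℝ (H u) v = inner ℝ u (H v))
    (hHμ : ∀ u, μ * ‖u‖ ^ 2 ≤ inner ℝ (H u) u) (hHL : ∀ u, inner ℝ (H u) u ≤ L * ‖u‖ ^ 2)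
    (vs : E q) (n : ℕ) :
    ‖((hbStep (4 / (√L + √μ) ^ 2) (max ((1 - √(4 / (√L + √μ) ^ 2 * μ)) ^ 2)
        ((1 - √(4 / (√L + √μ) ^ 2 * L)) ^ 2)) H (H vs))^[n] ⟨0, 0, 0⟩).v - vs‖
      ≤ 2 * (√(L / μ) + 1) * Real.exp (-(n / (√(L / μ) + 1))) * ‖vs‖ := by
  have hL : 0 < L := hμ.trans_le hμL
  obtain ⟨m, hm, rfl⟩ : ∃ m : ℝ, 0 < m ∧ μ = m ^ 2 :=
    ⟨√μ, Real.sqrt_pos.2 hμ, (Real.sq_sqrt hμ.le).symm⟩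
  obtain ⟨l, hl, rfl⟩ : ∃ l : ℝ, 0 < l ∧ L = l ^ 2 :=
    ⟨√L, Real.sqrt_pos.2 hL, (Real.sq_sqrt hL.le).symm⟩
  have hml : m ≤ l := (pow_le_pow_iff_left₀ hm.le hl.le two_ne_zero).1 hμL
  rw [← div_pow, Real.sqrt_sq hm.le, Real.sqrt_sq hl.le, Real.sqrt_sq (by positivity)]
  set lam := 4 / (l + m) ^ 2 with hlam
  have s1 : √(lam * m ^ 2) = 2 * m / (l + m) := by
    rw [show lam * m ^ 2 = (2 * m / (l + m)) ^ 2 by rw [hlam]; field_simp; norm_num,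
      Real.sqrt_sq (by positivity)]
  have s2 : √(lam * l ^ 2) = 2 * l / (l + m) := by
    rw [show lam * l ^ 2 = (2 * l / (l + m)) ^ 2 by rw [hlam]; field_simp; norm_num,
      Real.sqrt_sq (by positivity)]
  set r := (l - m) / (l + m) with hr
  have hr0 : 0 ≤ r := div_nonneg (by linarith) (by positivity)
  have hr1 : r ≤ 1 := (div_le_one (by positivity)).2 (by linarith)
  have t1 : 1 - √(lam * m ^ 2) = r := by rw [s1, hr]; field_simp; ring
  have t2 : 1 - √(lam * l ^ 2) = - r := by rw [s2, hr]; field_simp; ring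
  rw [t1, t2, neg_sq, max_self]
  have hlam0 : 0 < lam := by positivity
  -- The choice of `lam` and `θ = r²` sends the spectral interval `[μ, L]` of `H` exactly onto
  -- `[-2r, 2r]`.
  have i1 : 1 + r ^ 2 - lam * m ^ 2 = 2 * r := by rw [hr, hlam]; field_simp; ring
  have i2 : 1 + r ^ 2 - lam * l ^ 2 = -(2 * r) := by rw [hr, hlam]; field_simp; ring
  let A : E q →ₗ[ℝ] E q := (1 + r ^ 2) • LinearMap.id - lam • (H : E q →ₗ[ℝ] E q)
  have hA1 : ∀ u, A u = (1 + r ^ 2) • u - lam • H u := fun u => rfl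
  have hA : ∀ u, ‖(1 + r ^ 2) • u - lam • H u‖ ≤ 2 * r * ‖u‖ := by
    refine norm_apply_le_of_abs_inner_le (A := A) (fun u v => ?_) (fun u => ?_)
    · simp only [hA1, inner_sub_left, inner_sub_right, real_inner_smul_left, inner_smul_right, hH]
    · rw [hA1, inner_sub_left, real_inner_smul_left, real_inner_smul_left,
        real_inner_self_eq_norm_sq, abs_le]
      have h1 := mul_le_mul_of_nonneg_left (hHμ u) hlam0.le
      have h2 := mul_le_mul_of_nonneg_left (hHL u) hlam0.le
      constructor
      · linear_combination h2 - ‖u‖ ^ 2 * i2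
      · linear_combination h1 + ‖u‖ ^ 2 * i1
  refine (hb_norm_sub_le_aux hr0 hr1 hH hA vs n).trans ?_
  refine mul_le_mul_of_nonneg_right ?_ (norm_nonneg _)
  have hk1 : 1 ≤ l / m := (one_le_div hm).2 hml
  set k := l / m with hk
  have hk0 : 0 < k + 1 := by linarith
  have e1 : r ≤ Real.exp (-(2 / (k + 1))) := by
    have : r = -(2 / (k + 1)) + 1 := by rw [hr, hk]; field_simp; ring
    rw [this]; exact Real.add_one_le_exp _
  -- One of the two exponential factors will absorb `2n + 1`; the other is the stated rate.
  have e2 : r ^ n ≤ Real.exp (-(n / (k + 1))) * Real.exp (-(n / (k + 1))) := by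
    calc r ^ n ≤ Real.exp (-(2 / (k + 1))) ^ n := by gcongr
      _ = _ := by rw [← Real.exp_nat_mul, ← Real.exp_add]; congr 1; ring
  have e3 : (2 * n + 1 : ℝ) * Real.exp (-(n / (k + 1))) ≤ 2 * (k + 1) := by
    rw [Real.exp_neg, ← div_eq_mul_inv, div_le_iff₀ (Real.exp_pos _)]
    have := Real.add_one_le_exp ((n : ℝ) / (k + 1))
    calc (2 * n + 1 : ℝ) ≤ 2 * (k + 1) * (n / (k + 1) + 1) := by
          field_simp; nlinarith
      _ ≤ _ := by gcongr
  calc (2 * n + 1 : ℝ) * r ^ n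
      ≤ (2 * n + 1) * (Real.exp (-(n / (k + 1))) * Real.exp (-(n / (k + 1)))) := by gcongr
    _ = ((2 * n + 1) * Real.exp (-(n / (k + 1)))) * Real.exp (-(n / (k + 1))) := by ring
    _ ≤ _ := by gcongr

end HeavyBall
end Bilevel
end

noncomputable section
namespace Bilevel
open Filter Topology Asymptotics

/-! ### Partial gradients and the total derivative. -/

section Partial
variable {p q : ℕ}

theorem fderiv_apply_eq_add_partial {X Y Z : Type*} [NormedAddCommGroup X] [NormedSpace ℝ X]
    [NormedAddCommGroup Y] [NormedSpace ℝ Y] [NormedAddCommGroup Z] [NormedSpace ℝ Z]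
    {F : X × Y → Z} {x : X} {y : Y} (hF : DifferentiableAt ℝ F (x, y)) (a : X) (b : Y) :
    fderiv ℝ F (x, y) (a, b)
      = fderiv ℝ (fun x' => F (x', y)) x a + fderiv ℝ (fun y' => F (x, y')) y b := by
  have h1 : HasFDerivAt (fun x' => F (x', y)) _ x :=
    hF.hasFDerivAt.comp x (hasFDerivAt_prodMk_left x y)
  have h2 : HasFDerivAt (fun y' => F (x, y')) _ y :=
    hF.hasFDerivAt.comp y (hasFDerivAt_prodMk_right x y)
  rw [h1.fderiv, h2.fderiv]
  simp [← map_add]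

theorem hasGradientAt_gradY {f : E p → E q → ℝ}
    (hf : ContDiff ℝ 1 fun w : E p × E q => f w.1 w.2) (x : E p) (y : E q) :
    HasGradientAt (f x) (gradY f x y) y := by
  have h1 : ContDiff ℝ 1 (f x) := hf.comp (contDiff_prodMk_right x)
  exact (h1.differentiable one_ne_zero y).hasGradientAt

theorem hasGradientAt_gradX {f : E p → E q → ℝ}
    (hf : ContDiff ℝ 1 fun w : E p × E q => f w.1 w.2) (x : E p) (y : E q) :
    HasGradientAt (fun x' => f x' y) (gradX f x y) x := by
  have h1 : ContDiff ℝ 1 (fun x' => f x' y) := hf.comp (contDiff_prodMk_left y)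
  exact (h1.differentiable one_ne_zero x).hasGradientAt

theorem fderiv_uncurry_apply {f : E p → E q → ℝ}
    (hf : ContDiff ℝ 1 fun w : E p × E q => f w.1 w.2) (x : E p) (y : E q) (a : E p) (b : E q) :
    fderiv ℝ (fun w : E p × E q => f w.1 w.2) (x, y) (a, b)
      = inner ℝ (gradX f x y) a + inner ℝ (gradY f x y) b := by
  rw [fderiv_apply_eq_add_partial (hf.differentiable one_ne_zero _)]
  have h1 := (hasGradientAt_gradX hf x y).fderiv_apply (y := a)
  have h2 := (hasGradientAt_gradY hf x y).fderiv_apply (y := b)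
  exact congrArg₂ _ h1 h2

end Partial

namespace IsSCSC
variable {p q : ℕ} {Lx Lxy Ly Lgxy Lgy ρxy ρyy μx μy U : ℝ} {f g : E p → E q → ℝ}

/-! ### The lower-level problem: its solution map and its Hessian. -/

section Lower

theorem g_ge (h : IsSCSC Lx Lxy Ly Lgxy Lgy ρxy ρyy μx μy f g) (x : E p) (y y' : E q) :
    g x y + inner ℝ (gradY g x y) (y' - y) + μy / 2 * ‖y' - y‖ ^ 2 ≤ g x y' :=
  strongConvexOn_gradient_le (h.g_strongConvex x) (hasGradientAt_gradY h.g_contDiff x y) y'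

theorem g_le (h : IsSCSC Lx Lxy Ly Lgxy Lgy ρxy ρyy μx μy f g) (x : E p) (y y' : E q) :
    g x y' ≤ g x y + inner ℝ (gradY g x y) (y' - y) + Lgy / 2 * ‖y' - y‖ ^ 2 :=
  le_of_lipschitz_gradient (fun y => hasGradientAt_gradY h.g_contDiff x y)
    (h.gradY_g_lip_y x) y y'

theorem inner_gradY_sub_ge (h : IsSCSC Lx Lxy Ly Lgxy Lgy ρxy ρyy μx μy f g) (x : E p)
    (y y' : E q) :
    μy * ‖y - y'‖ ^ 2 ≤ inner ℝ (gradY g x y - gradY g x y') (y - y') := by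
  have h1 := h.g_ge x y y'
  have h2 := h.g_ge x y' y
  rw [norm_sub_rev, ← neg_sub y y', inner_neg_right] at h1
  rw [inner_sub_left]
  linarith

theorem norm_gradY_sub_ge (h : IsSCSC Lx Lxy Ly Lgxy Lgy ρxy ρyy μx μy f g) (x : E p)
    (y y' : E q) : μy * ‖y - y'‖ ≤ ‖gradY g x y - gradY g x y'‖ := by
  have h1 := (h.inner_gradY_sub_ge x y y').trans (real_inner_le_norm _ _)
  rcases (norm_nonneg (y - y')).eq_or_lt with h0 | h0
  · rw [← h0]; simp
  · refine le_of_mul_le_mul_right ?_ h0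
    linarith

theorem isMinOn_lowerSol (h : IsSCSC Lx Lxy Ly Lgxy Lgy ρxy ρyy μx μy f g) (hμ : 0 < μy)
    (x : E p) : IsMinOn (g x) Set.univ (lowerSol g x) := by
  have hex : ∃ y, IsMinOn (g x) Set.univ y := by
    have hcont : Continuous (g x) := (h.g_contDiff.comp (contDiff_prodMk_right x)).continuous
    have hlim : Tendsto (g x) (cocompact (E q)) atTop := by
      have h1 : Tendsto (fun t : ℝ => g x 0 + t * (μy / 2 * t - ‖gradY g x 0‖)) atTop atTop := by
        refine tendsto_atTop_add_const_left _ _ (tendsto_id.atTop_mul_atTop₀ ?_)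
        exact tendsto_atTop_add_const_right _ _ (tendsto_id.const_mul_atTop (by positivity))
      refine tendsto_atTop_mono (fun y => ?_) (h1.comp (tendsto_norm_cocompact_atTop (E := E q)))
      have h2 := h.g_ge x 0 y
      have h3 := (abs_le.1 (abs_real_inner_le_norm (gradY g x 0) y)).1
      simp only [sub_zero] at h2
      simp only [Function.comp]
      linarith
    obtain ⟨y, hy⟩ := hcont.exists_forall_le hlim
    exact ⟨y, fun z _ => hy z⟩
  exact Classical.epsilon_spec hex

theorem gradY_lowerSol (h : IsSCSC Lx Lxy Ly Lgxy Lgy ρxy ρyy μx μy f g) (hμ : 0 < μy)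
    (x : E p) : gradY g x (lowerSol g x) = 0 := by
  have h1 : IsLocalMin (g x) (lowerSol g x) :=
    (h.isMinOn_lowerSol hμ x).isLocalMin univ_mem
  have h2 := h1.hasFDerivAt_eq_zero (hasGradientAt_gradY h.g_contDiff x _).hasFDerivAt
  simpa using h2

/-- At `y*(x₂)` the gradient of `g x₂` vanishes, so that of `g x₁` has size at most `Lgxy ‖x₁ -
x₂‖`; strong monotonicity turns this into a distance to `y*(x₁)`. -/
theorem lowerSol_lip (h : IsSCSC Lx Lxy Ly Lgxy Lgy ρxy ρyy μx μy f g) (hμ : 0 < μy)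
    (x₁ x₂ : E p) : ‖lowerSol g x₁ - lowerSol g x₂‖ ≤ Lgxy / μy * ‖x₁ - x₂‖ := by
  have h1 := h.norm_gradY_sub_ge x₁ (lowerSol g x₁) (lowerSol g x₂)
  have h2 := h.gradY_g_lip_x x₁ x₂ (lowerSol g x₂)
  rw [h.gradY_lowerSol hμ] at h1 h2
  rw [zero_sub, norm_neg] at h1
  rw [sub_zero] at h2
  rw [div_mul_eq_mul_div, le_div_iff₀ hμ]
  linarith

theorem hasFDerivAt_gradY (h : IsSCSC Lx Lxy Ly Lgxy Lgy ρxy ρyy μx μy f g) (x : E p) (y : E q) :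
    HasFDerivAt (gradY g x) (hessY g x y) y :=
  ((h.gradY_g_contDiff.comp (contDiff_prodMk_right x)).differentiable one_ne_zero y).hasFDerivAt

theorem hessY_symm (h : IsSCSC Lx Lxy Ly Lgxy Lgy ρxy ρyy μx μy f g) (x : E p) (y u v : E q) :
    inner ℝ (hessY g x y u) v = inner ℝ u (hessY g x y v) := by
  let T : E q →L[ℝ] (E q →L[ℝ] ℝ) :=
    (isBoundedBilinearMap_inner (𝕜 := ℝ) (E := E q)).toContinuousLinearMap
  have h1 : HasFDerivAt (fun y' => T (gradY g x y')) (T.comp (hessY g x y)) y :=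
    T.hasFDerivAt.comp y (h.hasFDerivAt_gradY x y)
  have h2 := second_derivative_symmetric (f := g x) (f' := fun y' => T (gradY g x y'))
    (fun y' => (hasGradientAt_gradY h.g_contDiff x y').hasFDerivAt) h1 u v
  have h3 : inner ℝ (hessY g x y u) v = inner ℝ (hessY g x y v) u := h2
  rw [h3, real_inner_comm]

theorem tendsto_slope_inner_gradY (h : IsSCSC Lx Lxy Ly Lgxy Lgy ρxy ρyy μx μy f g) (x : E p)
    (y u : E q) :
    Tendsto (fun t : ℝ => t⁻¹ * inner ℝ (gradY g x (y + t • u) - gradY g x y) u) (𝓝[>] 0)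
      (𝓝 (inner ℝ (hessY g x y u) u)) := by
  have h1 : HasDerivAt (fun t : ℝ => y + t • u) u 0 := by
    simpa using ((hasDerivAt_id (0 : ℝ)).smul_const u).const_add y
  have h0 : HasFDerivAt (gradY g x) (hessY g x y) (y + (0 : ℝ) • u) := by
    rw [zero_smul, add_zero]; exact h.hasFDerivAt_gradY x y
  have h2 : HasDerivAt (fun t : ℝ => gradY g x (y + t • u)) (hessY g x y u) 0 :=
    h0.comp_hasDerivAt (0 : ℝ) h1
  have h3 := h2.tendsto_slope_zero_right.inner (𝕜 := ℝ) (tendsto_const_nhds (x := u))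
  simpa only [zero_add, zero_smul, add_zero, real_inner_smul_left] using h3

theorem inner_hessY_ge (h : IsSCSC Lx Lxy Ly Lgxy Lgy ρxy ρyy μx μy f g) (x : E p) (y u : E q) :
    μy * ‖u‖ ^ 2 ≤ inner ℝ (hessY g x y u) u := by
  refine ge_of_tendsto (h.tendsto_slope_inner_gradY x y u) ?_
  filter_upwards [self_mem_nhdsWithin] with t ht
  have ht : 0 < t := ht
  have h4 := h.inner_gradY_sub_ge x (y + t • u) y
  rw [add_sub_cancel_left, norm_smul, inner_smul_right, Real.norm_of_nonneg ht.le] at h4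
  rw [inv_mul_eq_div, le_div_iff₀ ht]
  refine le_of_mul_le_mul_left ?_ ht
  linarith

theorem norm_hessY_ge (h : IsSCSC Lx Lxy Ly Lgxy Lgy ρxy ρyy μx μy f g) (x : E p) (y u : E q) :
    μy * ‖u‖ ≤ ‖hessY g x y u‖ := by
  have h1 := (h.inner_hessY_ge x y u).trans (real_inner_le_norm _ _)
  rcases (norm_nonneg u).eq_or_lt with h0 | h0
  · rw [← h0]; simp
  · refine le_of_mul_le_mul_right ?_ h0
    linarith

theorem inner_hessY_le (h : IsSCSC Lx Lxy Ly Lgxy Lgy ρxy ρyy μx μy f g) (x : E p) (y u : E q) :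
    inner ℝ (hessY g x y u) u ≤ Lgy * ‖u‖ ^ 2 := by
  refine le_of_tendsto (h.tendsto_slope_inner_gradY x y u) ?_
  filter_upwards [self_mem_nhdsWithin] with t ht
  have ht : 0 < t := ht
  have h4 := h.gradY_g_lip_y x (y + t • u) y
  rw [add_sub_cancel_left, norm_smul, Real.norm_of_nonneg ht.le] at h4
  rw [inv_mul_eq_div, div_le_iff₀ ht]
  have h5 := real_inner_le_norm (gradY g x (y + t • u) - gradY g x y) u
  nlinarith [norm_nonneg u]

theorem exists_hessY_eq (h : IsSCSC Lx Lxy Ly Lgxy Lgy ρxy ρyy μx μy f g) (hμ : 0 < μy)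
    (x : E p) (y b : E q) : ∃ v, hessY g x y v = b := by
  have hinj : Function.Injective (hessY g x y : E q →ₗ[ℝ] E q) := by
    rw [← LinearMap.ker_eq_bot, LinearMap.ker_eq_bot']
    intro u hu
    have h1 := h.norm_hessY_ge x y u
    rw [show hessY g x y u = 0 from hu, norm_zero] at h1
    have h2 := norm_nonneg u
    rw [← norm_eq_zero]
    nlinarith
  exact LinearMap.injective_iff_surjective.1 hinj b

theorem norm_jacXY_le (h : IsSCSC Lx Lxy Ly Lgxy Lgy ρxy ρyy μx μy f g) (hL : 0 ≤ Lgxy)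
    (x : E p) (y : E q) : ‖jacXY g x y‖ ≤ Lgxy := by
  rw [jacXY, LinearIsometryEquiv.norm_map]
  refine norm_fderiv_le_of_lipschitz ℝ (C := ⟨Lgxy, hL⟩) ?_
  refine LipschitzWith.of_dist_le_mul fun x₁ x₂ => ?_
  rw [dist_eq_norm, dist_eq_norm]
  exact h.gradY_g_lip_x x₁ x₂ y

theorem μy_le (h : IsSCSC Lx Lxy Ly Lgxy Lgy ρxy ρyy μx μy f g) (hq : 1 ≤ q) : μy ≤ Lgy := by
  have : Nonempty (Fin q) := ⟨⟨0, hq⟩⟩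
  obtain ⟨u, hu⟩ := exists_ne (0 : E q)
  have h1 := (h.norm_gradY_sub_ge 0 u 0).trans (h.gradY_g_lip_y 0 u 0)
  rw [sub_zero] at h1
  exact le_of_mul_le_mul_right h1 (norm_pos_iff.2 hu)

end Lower

/-! ### The gradient of `Φ`, its Lipschitz constant and its approximation. -/

section Hypergradient

/-- Differentiability of `y*` is not needed, only its Lipschitz bound. Expand `f` and `∇_y g` to
first order along `(x', y*(x'))`. The expansion of `∇_y g` has value zero; paired with `v` and
subtracted from that of `f`, it cancels the unknown `y*(x') - y*(x)`, since `⟪v, H w⟫ = ⟪∇_y f, w⟫`.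
-/
theorem hasGradientAt_objective (h : IsSCSC Lx Lxy Ly Lgxy Lgy ρxy ρyy μx μy f g) (hμ : 0 < μy)
    (x : E p) {v : E q}
    (hv : hessY g x (lowerSol g x) v = gradY f x (lowerSol g x)) :
    HasGradientAt (objective f g)
      (gradX f x (lowerSol g x) - jacXY g x (lowerSol g x) v) x := by
  set y := lowerSol g x with hy
  have hO : (fun x' => (x', lowerSol g x') - (x, y)) =O[𝓝 x] fun x' => x' - x := by
    refine IsBigO.of_bound (1 + Lgxy / μy) (Eventually.of_forall fun x' => ?_)
    have h1 := h.lowerSol_lip hμ x' x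
    have h2 := (norm_nonneg _).trans h1
    rw [Prod.mk_sub_mk, Prod.norm_mk, add_mul, one_mul]
    refine max_le (by linarith) ?_
    rw [hy]
    linarith [norm_nonneg (x' - x)]
  have hT : Tendsto (fun x' => (x', lowerSol g x')) (𝓝 x) (𝓝 (x, y)) := by
    have h1 : Tendsto (fun x' => (x', lowerSol g x') - (x, y)) (𝓝 x) (𝓝 0) :=
      hO.trans_tendsto (by simpa using (continuous_id.sub continuous_const).tendsto (f := fun x' : E p => x' - x) x)
    simpa using h1.add_const (x, y)
  have hf := ((h.f_contDiff.differentiable one_ne_zero (x, y)).hasFDerivAt.isLittleO.comp_tendsto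
    hT).trans_isBigO hO
  have hgd := h.gradY_g_contDiff.differentiable one_ne_zero (x, y)
  have hg := (hgd.hasFDerivAt.isLittleO.comp_tendsto hT).trans_isBigO hO
  have hg2 := ((innerSL ℝ v).isBigO_comp _ _).trans_isLittleO hg
  rw [hasGradientAt_iff_isLittleO]
  refine (hf.sub hg2).congr_left fun x' => ?_
  have e1 := fderiv_uncurry_apply h.f_contDiff x y (x' - x) (lowerSol g x' - y)
  have e2 := fderiv_apply_eq_add_partial hgd (x' - x) (lowerSol g x' - y)
  simp only [Function.comp, Prod.mk_sub_mk, e1, h.gradY_lowerSol hμ]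
  have e3 : gradY g x y = 0 := h.gradY_lowerSol hμ x
  have e4 : inner ℝ v (hessY g x y (lowerSol g x' - y))
      = inner ℝ (gradY f x y) (lowerSol g x' - y) := by rw [← h.hessY_symm, hv]
  rw [e2, e3]
  have e5 : inner ℝ (jacXY g x y v) (x' - x)
      = inner ℝ v (fderiv ℝ (fun x' => gradY g x' y) x (x' - x)) :=
    ContinuousLinearMap.adjoint_inner_left _ _ _
  rw [inner_sub_left, e5, innerSL_apply_apply, sub_zero, zero_sub, inner_neg_right, inner_add_right]
  change _ - -(_ + inner ℝ v (hessY g x y (lowerSol g x' - y))) = _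
  rw [e4]
  simp only [objective, ← hy]
  ring

/-- Comparison of two solutions of linear systems with the Hessian. -/
theorem norm_hess_solution_sub_le (h : IsSCSC Lx Lxy Ly Lgxy Lgy ρxy ρyy μx μy f g) (hμ : 0 < μy)
    {x₁ x₂ : E p} {y₁ y₂ v₁ v₂ b₁ b₂ : E q} (h₁ : hessY g x₁ y₁ v₁ = b₁)
    (h₂ : hessY g x₂ y₂ v₂ = b₂) {B s : ℝ} (hb : ‖b₁ - b₂‖ ≤ B) (hU : ‖b₂‖ ≤ U)
    (hs : ‖hessY g x₁ y₁ - hessY g x₂ y₂‖ ≤ s) :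
    ‖v₁ - v₂‖ ≤ B / μy + s * U / μy ^ 2 := by
  have h3 := h.norm_hessY_ge x₁ y₁ (v₁ - v₂)
  have h4 := h.norm_hessY_ge x₂ y₂ v₂
  rw [h₂] at h4
  -- The change of the Hessian falls on `v₂`, whose norm is at most `U / μy`.
  have e : hessY g x₁ y₁ (v₁ - v₂) = (b₁ - b₂) - (hessY g x₁ y₁ - hessY g x₂ y₂) v₂ := by
    rw [map_sub, h₁, _root_.sub_apply, h₂]; abel
  rw [e] at h3
  have h5 := (norm_sub_le (b₁ - b₂) ((hessY g x₁ y₁ - hessY g x₂ y₂) v₂))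
  have h6 := (hessY g x₁ y₁ - hessY g x₂ y₂).le_opNorm v₂
  have h7 : ‖v₂‖ ≤ U / μy := by rw [le_div_iff₀ hμ]; linarith
  have h8 : ‖hessY g x₁ y₁ - hessY g x₂ y₂‖ * ‖v₂‖ ≤ s * (U / μy) := by
    gcongr
    exact (norm_nonneg _).trans hs
  calc ‖v₁ - v₂‖ ≤ (B + s * (U / μy)) / μy := by rw [le_div_iff₀ hμ]; linarith
    _ = _ := by field_simp

theorem norm_solution_le (h : IsSCSC Lx Lxy Ly Lgxy Lgy ρxy ρyy μx μy f g) (hμ : 0 < μy)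
    {x : E p} {y v b : E q} (hv : hessY g x y v = b) (hU : ‖b‖ ≤ U) : ‖v‖ ≤ U / μy := by
  have h4 := h.norm_hessY_ge x y v
  rw [hv] at h4
  rw [le_div_iff₀ hμ]; linarith

theorem sqrt_sq_add_sq_le {a b : ℝ} (ha : 0 ≤ a) (hb : 0 ≤ b) : √(a ^ 2 + b ^ 2) ≤ a + b := by
  rw [Real.sqrt_le_left (by positivity)]
  nlinarith [mul_nonneg ha hb]

theorem jacXY_solution_sub_le (h : IsSCSC Lx Lxy Ly Lgxy Lgy ρxy ρyy μx μy f g)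
    (hLgxy : 0 ≤ Lgxy) {x₁ x₂ : E p} {y₁ y₂ v₁ v₂ : E q} {a : ℝ} (hv : ‖v₁ - v₂‖ ≤ a)
    {s B : ℝ} (hs : ‖jacXY g x₁ y₁ - jacXY g x₂ y₂‖ ≤ s) (hB : ‖v₂‖ ≤ B) :
    ‖jacXY g x₁ y₁ v₁ - jacXY g x₂ y₂ v₂‖ ≤ Lgxy * a + s * B := by
  have e : jacXY g x₁ y₁ v₁ - jacXY g x₂ y₂ v₂
      = jacXY g x₁ y₁ (v₁ - v₂) + (jacXY g x₁ y₁ - jacXY g x₂ y₂) v₂ := by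
    rw [map_sub, _root_.sub_apply]; abel
  rw [e]
  refine (norm_add_le _ _).trans (add_le_add ?_ ?_)
  · refine ((jacXY g x₁ y₁).le_opNorm _).trans ?_
    gcongr
    exact h.norm_jacXY_le hLgxy _ _
  · refine ((jacXY g x₁ y₁ - jacXY g x₂ y₂).le_opNorm _).trans ?_
    gcongr
    exact (norm_nonneg _).trans hs

theorem differentiable_objective (h : IsSCSC Lx Lxy Ly Lgxy Lgy ρxy ρyy μx μy f g)
    (hμ : 0 < μy) : Differentiable ℝ (objective f g) := fun x => by
  obtain ⟨v, hv⟩ := h.exists_hessY_eq hμ x (lowerSol g x) (gradY f x (lowerSol g x))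
  exact (h.hasGradientAt_objective hμ x hv).differentiableAt

theorem gradient_objective_lip (h : IsSCSC Lx Lxy Ly Lgxy Lgy ρxy ρyy μx μy f g) (hμ : 0 < μy)
    (hLxy : 0 ≤ Lxy) (hLy : 0 ≤ Ly) (hLgxy : 0 ≤ Lgxy) (hρxy : 0 ≤ ρxy) (hρyy : 0 ≤ ρyy)
    (hU : ∀ x y, ‖gradY f x y‖ ≤ U) (x₁ x₂ : E p) :
    ‖gradient (objective f g) x₁ - gradient (objective f g) x₂‖
      ≤ smoothPhi Lx Lxy Ly Lgxy ρxy ρyy U μy * ‖x₁ - x₂‖ := by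
  obtain ⟨v₁, hv₁⟩ := h.exists_hessY_eq hμ x₁ (lowerSol g x₁) (gradY f x₁ (lowerSol g x₁))
  obtain ⟨v₂, hv₂⟩ := h.exists_hessY_eq hμ x₂ (lowerSol g x₂) (gradY f x₂ (lowerSol g x₂))
  rw [(h.hasGradientAt_objective hμ x₁ hv₁).gradient, (h.hasGradientAt_objective hμ x₂ hv₂).gradient]
  have hy := h.lowerSol_lip hμ x₁ x₂
  set y₁ := lowerSol g x₁
  set y₂ := lowerSol g x₂
  set l := Lgxy / μy with hl
  have hl0 : 0 ≤ l := by positivity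
  set d := ‖x₁ - x₂‖
  have hd0 : 0 ≤ d := norm_nonneg _
  have hsq : √(‖x₁ - x₂‖ ^ 2 + ‖y₁ - y₂‖ ^ 2) ≤ (1 + l) * d := by
    refine (sqrt_sq_add_sq_le (norm_nonneg _) (norm_nonneg _)).trans ?_
    linarith
  have k1 : ‖gradX f x₁ y₁ - gradX f x₂ y₂‖ ≤ Lx * d + Lxy * (l * d) := by
    calc _ ≤ ‖gradX f x₁ y₁ - gradX f x₂ y₁‖ + ‖gradX f x₂ y₁ - gradX f x₂ y₂‖ :=
          norm_sub_le_norm_sub_add_norm_sub _ _ _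
      _ ≤ Lx * ‖x₁ - x₂‖ + Lxy * ‖y₁ - y₂‖ :=
          add_le_add (h.gradX_f_lip_x _ _ _) (h.gradX_f_lip_y _ _ _)
      _ ≤ _ := by gcongr
  have k2 : ‖gradY f x₁ y₁ - gradY f x₂ y₂‖ ≤ Lxy * d + Ly * (l * d) := by
    calc _ ≤ ‖gradY f x₁ y₁ - gradY f x₂ y₁‖ + ‖gradY f x₂ y₁ - gradY f x₂ y₂‖ :=
          norm_sub_le_norm_sub_add_norm_sub _ _ _
      _ ≤ Lxy * ‖x₁ - x₂‖ + Ly * ‖y₁ - y₂‖ :=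
          add_le_add (h.gradY_f_lip_x _ _ _) (h.gradY_f_lip_y _ _ _)
      _ ≤ _ := by gcongr
  have k3 : ‖jacXY g x₁ y₁ - jacXY g x₂ y₂‖ ≤ ρxy * ((1 + l) * d) :=
    (h.jacXY_g_lip _ _ _ _).trans (by gcongr)
  have k4 : ‖hessY g x₁ y₁ - hessY g x₂ y₂‖ ≤ ρyy * ((1 + l) * d) :=
    (h.hessY_g_lip _ _ _ _).trans (by gcongr)
  have k5 := h.norm_hess_solution_sub_le hμ hv₁ hv₂ k2 (hU _ _) k4
  have k6 := h.jacXY_solution_sub_le hLgxy k5 k3 (h.norm_solution_le hμ hv₂ (hU _ _))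
  have e : gradX f x₁ y₁ - jacXY g x₁ y₁ v₁ - (gradX f x₂ y₂ - jacXY g x₂ y₂ v₂)
      = (gradX f x₁ y₁ - gradX f x₂ y₂) - (jacXY g x₁ y₁ v₁ - jacXY g x₂ y₂ v₂) := by abel
  rw [e]
  refine (norm_sub_le _ _).trans ((add_le_add k1 k6).trans (le_of_eq ?_))
  rw [smoothPhi, hl]
  field_simp
  ring

theorem objective_le (h : IsSCSC Lx Lxy Ly Lgxy Lgy ρxy ρyy μx μy f g) (hμ : 0 < μy)
    (hLxy : 0 ≤ Lxy) (hLy : 0 ≤ Ly) (hLgxy : 0 ≤ Lgxy) (hρxy : 0 ≤ ρxy) (hρyy : 0 ≤ ρyy)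
    (hU : ∀ x y, ‖gradY f x y‖ ≤ U) (x x' : E p) :
    objective f g x' ≤ objective f g x + inner ℝ (gradient (objective f g) x) (x' - x)
      + smoothPhi Lx Lxy Ly Lgxy ρxy ρyy U μy / 2 * ‖x' - x‖ ^ 2 :=
  le_of_lipschitz_gradient (fun x => (h.differentiable_objective hμ x).hasGradientAt)
    (h.gradient_objective_lip hμ hLxy hLy hLgxy hρxy hρyy hU) x x'

theorem objective_ge (h : IsSCSC Lx Lxy Ly Lgxy Lgy ρxy ρyy μx μy f g) (hμ : 0 < μy)
    (x x' : E p) :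
    objective f g x + inner ℝ (gradient (objective f g) x) (x' - x)
      + μx / 2 * ‖x' - x‖ ^ 2 ≤ objective f g x' :=
  strongConvexOn_gradient_le h.objective_strongConvex
    (h.differentiable_objective hμ x).hasGradientAt x'

/-- Upper and lower quadratic bounds are compared at two distinct points, `0` and the minimizer;
this is where `B > 0` enters. -/
theorem μx_le (h : IsSCSC Lx Lxy Ly Lgxy Lgy ρxy ρyy μx μy f g) (hμ : 0 < μy)
    (hLxy : 0 ≤ Lxy) (hLy : 0 ≤ Ly) (hLgxy : 0 ≤ Lgxy) (hρxy : 0 ≤ ρxy) (hρyy : 0 ≤ ρyy)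
    (hU : ∀ x y, ‖gradY f x y‖ ≤ U) :
    μx ≤ smoothPhi Lx Lxy Ly Lgxy ρxy ρyy U μy := by
  obtain ⟨xs, -, B, hB, hxs⟩ := h.exists_min
  have h1 := h.objective_le hμ hLxy hLy hLgxy hρxy hρyy hU 0 xs
  have h2 := h.objective_ge hμ 0 xs
  rw [sub_zero, hxs] at h1 h2
  have h3 : 0 < B ^ 2 := by positivity
  refine le_of_mul_le_mul_right ?_ h3
  linarith

theorem gradient_objective_min (h : IsSCSC Lx Lxy Ly Lgxy Lgy ρxy ρyy μx μy f g) (hμ : 0 < μy)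
    {xs : E p} (hxs : IsMinOn (objective f g) Set.univ xs) :
    gradient (objective f g) xs = 0 := by
  have h1 : IsLocalMin (objective f g) xs := hxs.isLocalMin univ_mem
  have h2 := h1.hasFDerivAt_eq_zero (h.differentiable_objective hμ xs).hasGradientAt.hasFDerivAt
  exact (InnerProductSpace.toDual ℝ (E p)).map_eq_zero_iff.1 h2

/-- Error of an approximate hypergradient computed from approximations of the lower-level solution
and of the solution of the linear system. -/
theorem hypergradient_error (h : IsSCSC Lx Lxy Ly Lgxy Lgy ρxy ρyy μx μy f g) (hμ : 0 < μy)
    (hLgxy : 0 ≤ Lgxy) (hU : ∀ x y, ‖gradY f x y‖ ≤ U) (x : E p) (y v : E q) {e : ℝ}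
    (hv : ∀ vs, hessY g x y vs = gradY f x y → ‖v - vs‖ ≤ e) :
    ‖gradX f x y - jacXY g x y v - gradient (objective f g) x‖
      ≤ (Lxy + ρxy * U / μy + Lgxy * (Ly / μy + ρyy * U / μy ^ 2)) * ‖y - lowerSol g x‖
        + Lgxy * e := by
  obtain ⟨v₁, hv₁⟩ := h.exists_hessY_eq hμ x y (gradY f x y)
  obtain ⟨v₂, hv₂⟩ := h.exists_hessY_eq hμ x (lowerSol g x) (gradY f x (lowerSol g x))
  rw [(h.hasGradientAt_objective hμ x hv₂).gradient]
  set ys := lowerSol g x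
  have hsq : √(‖x - x‖ ^ 2 + ‖y - ys‖ ^ 2) = ‖y - ys‖ := by
    rw [sub_self, norm_zero]; simp
  have k3 := h.jacXY_g_lip x y x ys
  have k4 := h.hessY_g_lip x y x ys
  rw [hsq] at k3 k4
  have k5 := h.norm_hess_solution_sub_le hμ hv₁ hv₂ (h.gradY_f_lip_y x y ys) (hU _ _) k4
  have k7 : ‖v - v₂‖ ≤ e + (Ly * ‖y - ys‖ / μy + ρyy * ‖y - ys‖ * U / μy ^ 2) :=
    (norm_sub_le_norm_sub_add_norm_sub _ v₁ _).trans (add_le_add (hv v₁ hv₁) k5)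
  have k6 := h.jacXY_solution_sub_le hLgxy k7 k3 (h.norm_solution_le hμ hv₂ (hU _ _))
  have e1 : gradX f x y - jacXY g x y v - (gradX f x ys - jacXY g x ys v₂)
      = (gradX f x y - gradX f x ys) - (jacXY g x y v - jacXY g x ys v₂) := by abel
  rw [e1]
  refine (norm_sub_le _ _).trans
    ((add_le_add (h.gradX_f_lip_y x y ys) k6).trans (le_of_eq ?_))
  field_simp
  ring

end Hypergradient
end IsSCSC
end Bilevel
end

noncomputable section
namespace Bilevel
open Filter Topology

/-! ### Lyapunov inequalities for the outer loop and its coupling with the warm start. -/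

section Outer

/-- One outer step decreases the Lyapunov function up to the error of the gradient. -/
theorem outer_lyapunov_step {F : Type*} [NormedAddCommGroup F] [InnerProductSpace ℝ F]
    {x z xt xs G d : F} {μ α L fxt fz fs fz' : ℝ} (hμ : 0 < μ) (hα : 0 < α) (hαL : α * L ≤ 1 / 2)
    (hαμ : α * μ ≤ 1)
    (hxt : xt = (√(α * μ) / (√(α * μ) + 2)) • x + (1 - √(α * μ) / (√(α * μ) + 2)) • z)
    (hz : fxt + inner ℝ d (z - xt) + μ / 2 * ‖z - xt‖ ^ 2 ≤ fz)
    (hs : fxt + inner ℝ d (xs - xt) + μ / 2 * ‖xs - xt‖ ^ 2 ≤ fs) (hfs : fs ≤ fz)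
    (hz' : fz' ≤ fxt + inner ℝ d (xt - α • G - xt) + L / 2 * ‖xt - α • G - xt‖ ^ 2) :
    fz' - fs + μ / 4 * ‖(√(α * μ) / 2) • xt + (1 - √(α * μ) / 2) • x - √(α / μ) • G - xs‖ ^ 2
      ≤ (1 - √(α * μ) / 2 / 2) * (fz - fs + μ / 4 * ‖x - xs‖ ^ 2)
        + (α / 2 + 2 * (√(α * μ) / 2) / μ) * ‖G - d‖ ^ 2
        - √(α * μ) / 2 * μ / 8 * ‖xt - xs‖ ^ 2 := by
  have ha0 : 0 < √(α * μ) := Real.sqrt_pos.2 (by positivity)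
  have ha1 : √(α * μ) ≤ 1 := Real.sqrt_le_one.2 hαμ
  have ha2 : √(α * μ) ^ 2 = α * μ := Real.sq_sqrt (by positivity)
  have hβ : √(α / μ) = √(α * μ) / μ := by
    rw [eq_div_iff hμ.ne', ← Real.sqrt_sq hμ.le, ← Real.sqrt_mul (by positivity),
      Real.sqrt_sq hμ.le]
    congr 1; field_simp
  set a := √(α * μ)
  set τ := a / 2 with hτ
  have hτ0 : 0 < τ := by positivity
  have hτ1 : τ ≤ 1 / 2 := by rw [hτ]; linarith
  -- Taking `w = μ/2` instead of `μ` leaves `-τμ/4 ‖xt - xs‖²`, which pays for the gradient error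
  -- here and for the motion of `y*` later.
  have key := accel_step (x := x) (z := z) (xt := xt) (xs := xs) (G := G) (d := d) (τ := τ)
    (β := √(α / μ)) (w := μ / 2) (μ := μ) (fxt := fxt) (fz := fz) (fs := fs) hτ0.le (by linarith)
    (by rw [hβ, hτ]; field_simp)
    (by
      rw [hxt, hτ]
      match_scalars <;> field_simp
      · ring
      · ring)
    (by have : 0 ≤ μ / 2 * ‖z - xt‖ ^ 2 := by positivity
        linarith) hs
  have hτβ : τ * √(α / μ) = α / 2 := by
    rw [hβ, hτ]; field_simp; linarith
  rw [hτβ] at key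
  have e3 : xt - α • G - xt = -(α • G) := by abel
  -- The `G` terms total at most `α/2 ‖G‖² - α ⟪d, G⟫ = α/2 (‖G - d‖² - ‖d‖²)`: one `α/4` comes from
  -- `τβ/2`, the other from `αL ≤ 1/2`.
  rw [e3, inner_neg_right, inner_smul_right, norm_neg, norm_smul, mul_pow, Real.norm_eq_abs,
    sq_abs] at hz'
  have k1 : L / 2 * (α ^ 2 * ‖G‖ ^ 2) ≤ α / 4 * ‖G‖ ^ 2 := by
    have : 0 ≤ α * ‖G‖ ^ 2 := by positivity
    nlinarith
  have k2 : ‖G - d‖ ^ 2 = ‖G‖ ^ 2 - 2 * inner ℝ d G + ‖d‖ ^ 2 := by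
    rw [norm_sub_sq_real, real_inner_comm]
  set u := (1 - τ) • (x - xs) + τ • (xt - xs) with hu
  have k3 : ‖u‖ ^ 2 ≤ (1 - τ) * ‖x - xs‖ ^ 2 + τ * ‖xt - xs‖ ^ 2 := by
    have h1 : ‖u‖ ≤ (1 - τ) * ‖x - xs‖ + τ * ‖xt - xs‖ := by
      refine (norm_add_le _ _).trans ?_
      rw [norm_smul, norm_smul, Real.norm_of_nonneg (by linarith), Real.norm_of_nonneg hτ0.le]
    calc ‖u‖ ^ 2 ≤ ((1 - τ) * ‖x - xs‖ + τ * ‖xt - xs‖) ^ 2 := by gcongr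
      _ ≤ _ := by
        have : 0 ≤ (1 - τ) * τ * (‖x - xs‖ - ‖xt - xs‖) ^ 2 := by
          have : 0 ≤ 1 - τ := by linarith
          positivity
        nlinarith
  -- Young's inequality. After `k3` the part `τμ/8 ‖x - xs‖²` costs half of the contraction, whence
  -- the factor `1 - τ/2`.
  have k4 : -inner ℝ (G - d) u ≤ 2 / μ * ‖G - d‖ ^ 2 + μ / 8 * ‖u‖ ^ 2 := by
    have h1 := (abs_le.1 (abs_real_inner_le_norm (G - d) u)).1
    have h2 : 0 ≤ μ / 8 * (4 / μ * ‖G - d‖ - ‖u‖) ^ 2 := by positivity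
    have h3 : μ / 8 * (4 / μ * ‖G - d‖ - ‖u‖) ^ 2
        = 2 / μ * ‖G - d‖ ^ 2 + μ / 8 * ‖u‖ ^ 2 - ‖G - d‖ * ‖u‖ := by field_simp; ring
    linarith
  have k5 := mul_le_mul_of_nonneg_left k4 hτ0.le
  have k6 := mul_le_mul_of_nonneg_left k3 (show 0 ≤ τ * (μ / 8) by positivity)
  have hX : 0 ≤ ‖xt - xs‖ ^ 2 := by positivity
  have hx : 0 ≤ μ * ‖x - xs‖ ^ 2 := by positivity
  have k7 : 0 ≤ μ / 2 / 2 * (1 - τ) * τ * ‖x - xt‖ ^ 2 := by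
    have : 0 ≤ 1 - τ := by linarith
    positivity
  have k8 : 0 ≤ α / 2 * ‖d‖ ^ 2 := by positivity
  have k9 : 0 ≤ τ * (fz - fs) := mul_nonneg hτ0.le (by linarith)
  have k10 : 0 ≤ τ * τ * (μ * ‖x - xs‖ ^ 2) := by positivity
  have k11 : 0 ≤ τ * (1 / 2 - τ) * (μ * ‖xt - xs‖ ^ 2) :=
    mul_nonneg (mul_nonneg hτ0.le (by linarith)) (by positivity)
  have k12 : τ * (2 / μ * ‖G - d‖ ^ 2) = 2 * τ / μ * ‖G - d‖ ^ 2 := by ring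
  have k13 : α / 2 * ‖G - d‖ ^ 2 = α / 2 * (‖G‖ ^ 2 - 2 * inner ℝ d G + ‖d‖ ^ 2) := by rw [k2]
  have k14 : 0 ≤ τ * (μ * ‖xt - xs‖ ^ 2) := by positivity
  linarith

/-- Coupling of the outer Lyapunov function with the error of the inner loop. -/
theorem coupled_lyapunov_step {V V' c₁ c₂ e h δ qq dd dd' l X A τ μ : ℝ} (hτ1 : τ ≤ 1)
    (hc₂ : 0 ≤ c₂) (he : 0 ≤ e) (hδ0 : 0 ≤ δ) (hdd' : 0 ≤ dd') (hA : 0 ≤ A)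
    (hV : V' ≤ (1 - τ / 2) * V + c₂ * e ^ 2 - τ * μ / 8 * X ^ 2) (heδ : e ≤ c₁ * δ + h)
    (hδ : δ ≤ qq * (dd + l * X)) (hd : dd' ≤ δ + l * X) (hAl : 20 * (A * l ^ 2) ≤ τ * μ)
    (hq : 8 * (c₂ * c₁ ^ 2 + A) * qq ^ 2 ≤ A) :
    V' + A * dd' ^ 2 ≤ (1 - τ / 2) * (V + A * dd ^ 2) + 2 * c₂ * h ^ 2 := by
  have h1 : e ^ 2 ≤ 2 * c₁ ^ 2 * δ ^ 2 + 2 * h ^ 2 := by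
    calc e ^ 2 ≤ (c₁ * δ + h) ^ 2 := by gcongr
      _ ≤ _ := by nlinarith [sq_nonneg (c₁ * δ - h)]
  have h2 : δ ^ 2 ≤ qq ^ 2 * (2 * (dd ^ 2 + l ^ 2 * X ^ 2)) := by
    calc δ ^ 2 ≤ (qq * (dd + l * X)) ^ 2 := by gcongr
      _ = qq ^ 2 * (dd + l * X) ^ 2 := by ring
      _ ≤ _ := by gcongr; nlinarith [sq_nonneg (dd - l * X)]
  have h3 : dd' ^ 2 ≤ 2 * δ ^ 2 + 2 * (l ^ 2 * X ^ 2) := by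
    calc dd' ^ 2 ≤ (δ + l * X) ^ 2 := by gcongr
      _ ≤ _ := by nlinarith [sq_nonneg (δ - l * X)]
  have h4 : 2 * (c₂ * c₁ ^ 2 + A) * δ ^ 2 ≤ A / 2 * (dd ^ 2 + l ^ 2 * X ^ 2) := by
    have h0 : 0 ≤ 2 * (c₂ * c₁ ^ 2 + A) := by positivity
    have h5 := mul_le_mul_of_nonneg_left h2 h0
    have h6 := mul_le_mul_of_nonneg_right hq (show 0 ≤ (dd ^ 2 + l ^ 2 * X ^ 2) / 2 by positivity)
    linarith
  have h5 := mul_le_mul_of_nonneg_left h1 hc₂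
  have h6 := mul_le_mul_of_nonneg_left h3 hA
  -- The `X²` terms sum to `(2 + 1/2) A l² X²`, which the constant 20 makes at most `τμ/8 X²`.
  have h7 := mul_le_mul_of_nonneg_right hAl (sq_nonneg X)
  have h8 : 0 ≤ (1 - τ) * (A * dd ^ 2) := mul_nonneg (by linarith) (by positivity)
  linarith

end Outer

/-! ### Oracle counts. -/

section Counters
variable {p q : ℕ}

theorem accBiOBG_complexity (t : ℝ) (P : Params) (f g : E p → E q → ℝ) (K : ℕ) :
    (accBiOBG P f g K).complexity t = K * (t * (1 + (P.M - 1 : ℕ)) + P.N + 2) := by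
  have h : (accBiOBG P f g K).nG = K * (P.N + 2) ∧ (accBiOBG P f g K).nJ = K ∧
      (accBiOBG P f g K).nH = K * (P.M - 1) := by
    induction K with
    | zero => simp [accBiOBG]
    | succ k ih =>
      obtain ⟨h1, h2, h3⟩ := ih
      simp only [accBiOBG, accBiOBGStep, agd_nG, hb_nH, h1, h2, h3, zero_add]
      refine ⟨?_, trivial, ?_⟩ <;> ring
  obtain ⟨h1, h2, h3⟩ := h
  rw [State.complexity, h1, h2, h3]
  push_cast
  ring

end Counters

/-! ### Convergence of the algorithm for given inner-loop lengths. -/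

namespace IsSCSC
variable {p q : ℕ} {Lx Lxy Ly Lgxy Lgy ρxy ρyy μx μy U : ℝ} {f g : E p → E q → ℝ}

/-- The joint Lyapunov function of the outer loop and of the warm start. -/
def lyap (f g : E p → E q → ℝ) (μx A : ℝ) (xs : E p) (S : State p q) : ℝ :=
  objective f g S.z - objective f g xs + μx / 4 * ‖S.x - xs‖ ^ 2
    + A * ‖S.y - lowerSol g xs‖ ^ 2

/-- The warm start is compared with the fixed point `y*(xs)` rather than with the moving target
`y*(xt)`; each exchange costs `l ‖xt - xs‖`. -/
theorem lyap_step (h : IsSCSC Lx Lxy Ly Lgxy Lgy ρxy ρyy μx μy f g) (hμx : 0 < μx)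
    (hμ : 0 < μy) (hLxy : 0 ≤ Lxy) (hLy : 0 ≤ Ly) (hLgxy : 0 ≤ Lgxy) (hρxy : 0 ≤ ρxy)
    (hρyy : 0 ≤ ρyy) (hU : ∀ x y, ‖gradY f x y‖ ≤ U) (hμL : μy ≤ Lgy) {α : ℝ} (hα : 0 < α)
    (hαL : α * smoothPhi Lx Lxy Ly Lgxy ρxy ρyy U μy ≤ 1 / 2) (hαμ : α * μx ≤ 1)
    {N M : ℕ} {τ l A c₁ c₂ e : ℝ}
    (hτ : τ = √(α * μx) / 2) (hτ1 : τ ≤ 1) (hl : l = Lgxy / μy) (hA0 : 0 ≤ A)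
    (hAl : 20 * (A * l ^ 2) ≤ τ * μx)
    (hc₁ : c₁ = Lxy + ρxy * U / μy + Lgxy * (Ly / μy + ρyy * U / μy ^ 2))
    (hc₂ : c₂ = α / 2 + 2 * τ / μx) (hc₂0 : 0 ≤ c₂)
    (hN : 8 * (c₂ * c₁ ^ 2 + A) * ((Lgy / μy + 1) * (1 - 1 / √(Lgy / μy)) ^ N) ≤ A)
    (he : e = Lgxy * (2 * (√(Lgy / μy) + 1)
      * Real.exp (-((M - 1 : ℕ) / (√(Lgy / μy) + 1))) * (U / μy)))
    {xs : E p} (hxs : IsMinOn (objective f g) Set.univ xs) (k : ℕ) (S : State p q) :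
    lyap f g μx A xs (accBiOBGStep (scscParams Lgy μx μy α N M) f g k S)
      ≤ (1 - τ / 2) * lyap f g μx A xs S + 2 * c₂ * e ^ 2 := by
  have hk1 : 1 ≤ √(Lgy / μy) := Real.one_le_sqrt.2 ((one_le_div hμ).2 hμL)
  have hrate : 0 ≤ (Lgy / μy + 1) * (1 - 1 / √(Lgy / μy)) ^ N := by
    have h1 : 0 ≤ 1 - 1 / √(Lgy / μy) := sub_nonneg.2 ((div_le_one (by linarith)).2 hk1)
    have h2 : 0 ≤ Lgy / μy := div_nonneg (hμ.le.trans hμL) hμ.le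
    positivity
  have hl0 : 0 ≤ l := by rw [hl]; positivity
  set P := scscParams Lgy μx μy α N M with hP
  set ys := lowerSol g xs with hys
  set xt := (√(α * μx) / (√(α * μx) + 2)) • S.x + (1 - √(α * μx) / (√(α * μx) + 2)) • S.z
    with hxt
  set S' := accBiOBGStep P f g k S with hS'
  let v : E q := ((hbStep P.lam P.θ (hessY g xt S'.y) (gradY f xt S'.y))^[M - 1] ⟨0, 0, 0⟩).v
  let G : E p := gradX f xt S'.y - jacXY g xt S'.y v
  have hSx : S'.x = (√(α * μx) / 2) • xt + (1 - √(α * μx) / 2) • S.x - √(α / μx) • G := rfl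
  have hSz : S'.z = xt - α • G := rfl
  have hSy : S'.y = ((agdStep Lgy (Lgy / μy) (gradY g xt))^[N] ⟨S.y, S.y, 0⟩).y := rfl
  have hinner : ‖S'.y - lowerSol g xt‖
      ≤ √((Lgy / μy + 1) * (1 - 1 / √(Lgy / μy)) ^ N) * (‖S.y - ys‖ + l * ‖xt - xs‖) := by
    have h1 := agd_dist_sq_le hμ hμL (h.g_ge xt) (h.g_le xt) (h.gradY_lowerSol hμ xt) S.y N
    rw [← hSy] at h1
    have h2 : ‖S.y - lowerSol g xt‖ ≤ ‖S.y - ys‖ + l * ‖xt - xs‖ := by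
      refine (norm_sub_le_norm_sub_add_norm_sub _ ys _).trans ?_
      have := h.lowerSol_lip hμ xs xt
      rw [norm_sub_rev xs xt] at this
      rw [hl]
      linarith
    calc _ ≤ √((Lgy / μy + 1) * (1 - 1 / √(Lgy / μy)) ^ N) * ‖S.y - lowerSol g xt‖ := by
          rw [← Real.sqrt_sq (norm_nonneg (S.y - lowerSol g xt)), ← Real.sqrt_mul hrate]
          exact Real.le_sqrt_of_sq_le h1
      _ ≤ _ := by gcongr
  have herr : ‖G - gradient (objective f g) xt‖ ≤ c₁ * ‖S'.y - lowerSol g xt‖ + e := by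
    rw [hc₁, he]
    refine h.hypergradient_error hμ hLgxy hU xt S'.y v fun vs hvs => ?_
    have h1 := hb_norm_sub_le hμ hμL (h.hessY_symm xt S'.y) (h.inner_hessY_ge xt S'.y)
      (h.inner_hessY_le xt S'.y) vs (M - 1)
    rw [hvs] at h1
    refine h1.trans ?_
    gcongr
    exact h.norm_solution_le hμ hvs (hU _ _)
  have hV := outer_lyapunov_step (xs := xs) (G := G) (fz' := (objective f g) S'.z) hμx hα hαL hαμ hxt
    (h.objective_ge hμ xt S.z) (h.objective_ge hμ xt xs) (hxs (Set.mem_univ S.z))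
    (by rw [hSz]; exact h.objective_le hμ hLxy hLy hLgxy hρxy hρyy hU xt (xt - α • G))
  rw [← hSx, ← hτ, ← hc₂] at hV
  have hd : ‖S'.y - ys‖ ≤ ‖S'.y - lowerSol g xt‖ + l * ‖xt - xs‖ := by
    refine (norm_sub_le_norm_sub_add_norm_sub _ (lowerSol g xt) _).trans ?_
    have := h.lowerSol_lip hμ xt xs
    rw [hl]
    linarith
  exact coupled_lyapunov_step hτ1 hc₂0 (norm_nonneg _) (norm_nonneg _) (norm_nonneg _) hA0
    hV herr hinner hd hAl (by rw [Real.sq_sqrt hrate]; exact hN)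

/-- Strong convexity gives `μx/2 ‖xs‖² ≤ Δ`, so neither `‖xs‖` nor `‖y*(xs)‖` appears in the bound.
-/
theorem lyap_zero_le (h : IsSCSC Lx Lxy Ly Lgxy Lgy ρxy ρyy μx μy f g) (hμx : 0 < μx)
    (hμ : 0 < μy) {P : Params} {τ l A : ℝ} (hA0 : 0 ≤ A) (hA1 : 20 * A ≤ μx) (hτ1 : τ ≤ 1)
    (hl : l = Lgxy / μy) (hAl : 20 * (A * l ^ 2) ≤ τ * μx) {xs : E p}
    (hxs : IsMinOn (objective f g) Set.univ xs) {Δ r : ℝ}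
    (hΔ : objective f g 0 - objective f g xs ≤ Δ) (hr : ‖lowerSol g 0‖ ≤ r) :
    lyap f g μx A xs (accBiOBG P f g 0) ≤ 2 * Δ + μx * r ^ 2 := by
  have h1 := h.objective_ge hμ xs 0
  rw [h.gradient_objective_min hμ hxs, inner_zero_left, zero_sub, norm_neg] at h1
  have h2 : ‖lowerSol g xs‖ ≤ r + l * ‖xs‖ := by
    have h3 := h.lowerSol_lip hμ xs 0
    rw [sub_zero, ← hl] at h3
    have h4 := norm_sub_norm_le (lowerSol g xs) (lowerSol g 0)
    linarith
  have h3 : ‖lowerSol g xs‖ ^ 2 ≤ 2 * r ^ 2 + 2 * (l ^ 2 * ‖xs‖ ^ 2) := by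
    calc ‖lowerSol g xs‖ ^ 2 ≤ (r + l * ‖xs‖) ^ 2 := by gcongr
      _ ≤ _ := by nlinarith [sq_nonneg (r - l * ‖xs‖)]
  have h4 := mul_le_mul_of_nonneg_left h3 hA0
  have h5 := mul_le_mul_of_nonneg_right hAl (sq_nonneg ‖xs‖)
  have h6 := mul_le_mul_of_nonneg_right hA1 (sq_nonneg r)
  have h7 := mul_le_mul_of_nonneg_right hτ1 (show 0 ≤ μx * ‖xs‖ ^ 2 by positivity)
  simp only [lyap, accBiOBG, zero_sub, norm_neg]
  have h8 : 0 ≤ μx * r ^ 2 := by positivity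
  have h9 : 0 ≤ μx * ‖xs‖ ^ 2 := by positivity
  linarith

/-- Convergence of AccBiO-BG with a sufficiently accurate inner loop. -/
theorem accBiOBG_sub_min_le (h : IsSCSC Lx Lxy Ly Lgxy Lgy ρxy ρyy μx μy f g) (hμx : 0 < μx)
    (hμ : 0 < μy) (hLxy : 0 ≤ Lxy) (hLy : 0 ≤ Ly) (hLgxy : 0 ≤ Lgxy) (hρxy : 0 ≤ ρxy)
    (hρyy : 0 ≤ ρyy) (hU : ∀ x y, ‖gradY f x y‖ ≤ U) (hμL : μy ≤ Lgy) {α : ℝ} (hα : 0 < α)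
    (hαL : α * smoothPhi Lx Lxy Ly Lgxy ρxy ρyy U μy ≤ 1 / 2) {N M : ℕ} {τ l A c₁ c₂ e : ℝ}
    (hτ : τ = √(α * μx) / 2) (hl : l = Lgxy / μy) (hA : A = τ * μx / (20 * (1 + l ^ 2)))
    (hc₁ : c₁ = Lxy + ρxy * U / μy + Lgxy * (Ly / μy + ρyy * U / μy ^ 2))
    (hc₂ : c₂ = α / 2 + 2 * τ / μx)
    (hN : 8 * (c₂ * c₁ ^ 2 + A) * ((Lgy / μy + 1) * (1 - 1 / √(Lgy / μy)) ^ N) ≤ A)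
    (he : e = Lgxy * (2 * (√(Lgy / μy) + 1)
      * Real.exp (-((M - 1 : ℕ) / (√(Lgy / μy) + 1))) * (U / μy)))
    {xs : E p} (hxs : IsMinOn (objective f g) Set.univ xs) {Δ r : ℝ}
    (hΔ : objective f g 0 - objective f g xs ≤ Δ) (hr : ‖lowerSol g 0‖ ≤ r) (K : ℕ) :
    objective f g (accBiOBG (scscParams Lgy μx μy α N M) f g K).z - objective f g xs
      ≤ (1 - τ / 2) ^ K * (2 * Δ + μx * r ^ 2) + 4 * c₂ * e ^ 2 / τ := by
  have hμxL := h.μx_le hμ hLxy hLy hLgxy hρxy hρyy hU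
  have hαμ : α * μx ≤ 1 := by
    have := mul_le_mul_of_nonneg_left hμxL hα.le
    linarith
  have ha0 : 0 < √(α * μx) := Real.sqrt_pos.2 (by positivity)
  have ha1 : √(α * μx) ≤ 1 := Real.sqrt_le_one.2 hαμ
  have hτ0 : 0 < τ := by rw [hτ]; positivity
  have hτ1 : τ ≤ 1 := by rw [hτ]; linarith
  have hl0 : 0 ≤ l := by rw [hl]; positivity
  have hA0 : 0 < A := by rw [hA]; positivity
  have hc₂0 : 0 < c₂ := by rw [hc₂]; positivity
  -- The `1` in `1 + l²` keeps `A` bounded by `μx / 20` even when `l` is small or zero.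
  have hAeq : 20 * (A * (1 + l ^ 2)) = τ * μx := by rw [hA]; field_simp
  have hAl : 20 * (A * l ^ 2) ≤ τ * μx := by linarith
  have hA1 : 20 * A ≤ μx := by
    have : 0 ≤ A * l ^ 2 := by positivity
    nlinarith
  have hstep := h.lyap_step hμx hμ hLxy hLy hLgxy hρxy hρyy hU hμL hα hαL hαμ hτ hτ1 hl hA0.le hAl
    hc₁ hc₂ hc₂0.le hN he hxs
  set P := scscParams Lgy μx μy α N M with hP
  -- `4 c₂ e² / τ` is the fixed point of the recursion, that is, the sum of the geometric series of
  -- errors.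
  have hfix : 2 * c₂ * e ^ 2 = τ / 2 * (4 * c₂ * e ^ 2 / τ) := by field_simp; ring
  have hnn : 0 ≤ 4 * c₂ * e ^ 2 / τ := by positivity
  set w := 4 * c₂ * e ^ 2 / τ
  have hW : ∀ k, lyap f g μx A xs (accBiOBG P f g k)
      ≤ (1 - τ / 2) ^ k * lyap f g μx A xs (accBiOBG P f g 0) + w := by
    intro k
    induction k with
    | zero => linarith
    | succ k ih =>
      refine (hstep k _).trans ?_
      rw [hfix, pow_succ']
      have := mul_le_mul_of_nonneg_left ih (show 0 ≤ 1 - τ / 2 by linarith)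
      linarith
  have hfin := (hW K).trans (add_le_add_left (mul_le_mul_of_nonneg_left
    (h.lyap_zero_le hμx hμ hA0.le hA1 hτ1 hl hAl hxs hΔ hr (P := P))
    (show 0 ≤ (1 - τ / 2) ^ K from pow_nonneg (by linarith) K)) w)
  have h2 : 0 ≤ μx / 4 * ‖(accBiOBG P f g K).x - xs‖ ^ 2 := by positivity
  have h3 : 0 ≤ A * ‖(accBiOBG P f g K).y - lowerSol g xs‖ ^ 2 := by positivity
  rw [lyap] at hfin
  linarith

end IsSCSC
end Bilevel
end

noncomputable section
namespace Bilevel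
open Filter Topology

/-! ### A calculus of polynomially bounded functions. -/

section PolyBdd

/-- `F` is bounded by a constant times a power of `T`. -/
def PolyBdd {ι : Type*} (T F : ι → ℝ) : Prop := ∃ A : ℝ, 0 ≤ A ∧ ∃ n : ℕ, ∀ i, |F i| ≤ A * T i ^ n

namespace PolyBdd
variable {ι : Type*} {T F G : ι → ℝ}

theorem const (c : ℝ) : PolyBdd T fun _ => c := ⟨|c|, abs_nonneg c, 0, fun i => by simp⟩

theorem of_abs_le (hG : PolyBdd T G) (h : ∀ i, |F i| ≤ |G i|) : PolyBdd T F := by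
  obtain ⟨A, hA, n, hn⟩ := hG
  exact ⟨A, hA, n, fun i => (h i).trans (hn i)⟩

theorem of_le (hG : PolyBdd T G) (h0 : ∀ i, 0 ≤ F i) (h : ∀ i, F i ≤ G i) : PolyBdd T F :=
  hG.of_abs_le fun i => abs_le_abs_of_nonneg (h0 i) (h i)

theorem of_le_base (h0 : ∀ i, 0 ≤ F i) (h : ∀ i, F i ≤ T i) : PolyBdd T F :=
  ⟨1, zero_le_one, 1, fun i => by rw [abs_of_nonneg (h0 i), one_mul, pow_one]; exact h i⟩

theorem mul (hF : PolyBdd T F) (hG : PolyBdd T G) : PolyBdd T fun i => F i * G i := by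
  obtain ⟨A, hA, n, hn⟩ := hF
  obtain ⟨B, hB, m, hm⟩ := hG
  refine ⟨A * B, mul_nonneg hA hB, n + m, fun i => ?_⟩
  rw [abs_mul, pow_add]
  calc |F i| * |G i| ≤ (A * T i ^ n) * (B * T i ^ m) :=
        mul_le_mul (hn i) (hm i) (abs_nonneg _) ((abs_nonneg _).trans (hn i))
    _ = _ := by ring

theorem pow (hF : PolyBdd T F) (k : ℕ) : PolyBdd T fun i => F i ^ k := by
  induction k with
  | zero => simpa using const 1
  | succ k ih => simpa only [pow_succ] using ih.mul hF

theorem add (hT : ∀ i, 1 ≤ T i) (hF : PolyBdd T F) (hG : PolyBdd T G) :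
    PolyBdd T fun i => F i + G i := by
  obtain ⟨A, hA, n, hn⟩ := hF
  obtain ⟨B, hB, m, hm⟩ := hG
  refine ⟨A + B, add_nonneg hA hB, n + m, fun i => (abs_add_le _ _).trans ?_⟩
  rw [add_mul]
  refine add_le_add ((hn i).trans ?_) ((hm i).trans ?_)
  · exact mul_le_mul_of_nonneg_left (pow_le_pow_right₀ (hT i) (Nat.le_add_right n m)) hA
  · exact mul_le_mul_of_nonneg_left (pow_le_pow_right₀ (hT i) (Nat.le_add_left m n)) hB

theorem div (hF : PolyBdd T F) (hG : PolyBdd T fun i => (G i)⁻¹) :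
    PolyBdd T fun i => F i / G i := by
  simpa only [div_eq_mul_inv] using hF.mul hG

theorem inv_pow (hG : PolyBdd T fun i => (G i)⁻¹) (k : ℕ) : PolyBdd T fun i => (G i ^ k)⁻¹ := by
  simpa only [_root_.inv_pow] using hG.pow k

end PolyBdd
end PolyBdd

/-! ### Polynomial bounds on the accuracy ratios, and the complexity estimate. -/

section Parameters

/-- Problem and stepsize parameters for which the problem class may be non-empty. -/
structure IsAdmissible (Lx Lxy Ly Lgxy ρxy ρyy c U Lgy μx μy α : ℝ) : Prop where
  U_nonneg : 0 ≤ U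
  μx_pos : 0 < μx
  μy_pos : 0 < μy
  μy_le : μy ≤ Lgy
  μx_le : μx ≤ smoothPhi Lx Lxy Ly Lgxy ρxy ρyy U μy
  le_α : c / smoothPhi Lx Lxy Ly Lgxy ρxy ρyy U μy ≤ α
  α_le : α ≤ 1 / (2 * smoothPhi Lx Lxy Ly Lgxy ρxy ρyy U μy)

/-- The Lipschitz constant of the hypergradient as a function of the lower-level variable. -/
def hyperLip (Lxy Ly Lgxy ρxy ρyy U μy : ℝ) : ℝ :=
  Lxy + ρxy * U / μy + Lgxy * (Ly / μy + ρyy * U / μy ^ 2)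

/-- The accuracy ratio required of the inner loop. -/
def innerRatio (Lxy Ly Lgxy ρxy ρyy U Lgy μx μy α : ℝ) : ℝ :=
  8 * (Lgy / μy + 1) * ((α / 2 + 2 * (√(α * μx) / 2) / μx)
    * hyperLip Lxy Ly Lgxy ρxy ρyy U μy ^ 2
    * (20 * (1 + (Lgxy / μy) ^ 2) / (√(α * μx) / 2 * μx)) + 1)

/-- The accuracy ratio required of the heavy-ball loop. -/
def heavyBallRatio (Lgxy U Lgy μx μy α : ℝ) : ℝ :=
  8 * (α / 2 + 2 * (√(α * μx) / 2) / μx) / (√(α * μx) / 2)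
    * (Lgxy * (2 * (√(Lgy / μy) + 1) * (U / μy))) ^ 2

namespace IsAdmissible
variable {Lx Lxy Ly Lgxy ρxy ρyy c U Lgy μx μy α : ℝ}

theorem smoothPhi_pos (h : IsAdmissible Lx Lxy Ly Lgxy ρxy ρyy c U Lgy μx μy α) :
    0 < smoothPhi Lx Lxy Ly Lgxy ρxy ρyy U μy := h.μx_pos.trans_le h.μx_le

theorem α_pos (h : IsAdmissible Lx Lxy Ly Lgxy ρxy ρyy c U Lgy μx μy α) (hc : 0 < c) : 0 < α :=
  (div_pos hc h.smoothPhi_pos).trans_le h.le_α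

theorem α_mul_le (h : IsAdmissible Lx Lxy Ly Lgxy ρxy ρyy c U Lgy μx μy α) :
    α * smoothPhi Lx Lxy Ly Lgxy ρxy ρyy U μy ≤ 1 / 2 := by
  have h1 := h.α_le
  have h2 := h.smoothPhi_pos
  rw [le_div_iff₀ (by positivity)] at h1
  linarith

theorem inv_α_le (h : IsAdmissible Lx Lxy Ly Lgxy ρxy ρyy c U Lgy μx μy α) (hc : 0 < c) :
    α⁻¹ ≤ smoothPhi Lx Lxy Ly Lgxy ρxy ρyy U μy / c := by
  have h1 := h.le_α
  rw [div_le_iff₀ h.smoothPhi_pos] at h1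
  rw [inv_le_iff_one_le_mul₀ (h.α_pos hc), div_mul_eq_mul_div, le_div_iff₀ hc]
  linarith

theorem α_mul_μx_le (h : IsAdmissible Lx Lxy Ly Lgxy ρxy ρyy c U Lgy μx μy α) (hc : 0 < c) :
    α * μx ≤ 1 / 2 :=
  (mul_le_mul_of_nonneg_left h.μx_le (h.α_pos hc).le).trans h.α_mul_le

theorem Lgy_pos (h : IsAdmissible Lx Lxy Ly Lgxy ρxy ρyy c U Lgy μx μy α) : 0 < Lgy :=
  h.μy_pos.trans_le h.μy_le

theorem one_le_κ (h : IsAdmissible Lx Lxy Ly Lgxy ρxy ρyy c U Lgy μx μy α) : 1 ≤ Lgy / μy :=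
  (one_le_div h.μy_pos).2 h.μy_le

/-- Both ratios are built by sums, products and powers from the parameters, the inverses of `μx`,
`μy` and `τ`, and square roots that are dominated by polynomially bounded functions. The exponent is
therefore never computed. -/
theorem exists_bound (Lx Lxy Ly Lgxy ρxy ρyy c : ℝ) (hc : 0 < c) :
    ∃ A : ℝ, 0 ≤ A ∧ ∃ n : ℕ, ∀ U Lgy μx μy α : ℝ,
      IsAdmissible Lx Lxy Ly Lgxy ρxy ρyy c U Lgy μx μy α →
      innerRatio Lxy Ly Lgxy ρxy ρyy U Lgy μx μy α
        ≤ A * (1 + (μx + μx⁻¹ + μy + μy⁻¹ + Lgy + U)) ^ n ∧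
      heavyBallRatio Lgxy U Lgy μx μy α
        ≤ A * (1 + (μx + μx⁻¹ + μy + μy⁻¹ + Lgy + U)) ^ n := by
  let ι := {w : ℝ × ℝ × ℝ × ℝ × ℝ //
    IsAdmissible Lx Lxy Ly Lgxy ρxy ρyy c w.1 w.2.1 w.2.2.1 w.2.2.2.1 w.2.2.2.2}
  let vU : ι → ℝ := fun w => w.1.1
  let vL : ι → ℝ := fun w => w.1.2.1
  let vx : ι → ℝ := fun w => w.1.2.2.1
  let vy : ι → ℝ := fun w => w.1.2.2.2.1
  let va : ι → ℝ := fun w => w.1.2.2.2.2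
  have adm : ∀ i, IsAdmissible Lx Lxy Ly Lgxy ρxy ρyy c (vU i) (vL i) (vx i) (vy i) (va i) :=
    fun i => i.2
  let T : ι → ℝ := fun i => 1 + (vx i + (vx i)⁻¹ + vy i + (vy i)⁻¹ + vL i + vU i)
  have px : ∀ i, 0 < vx i := fun i => (adm i).μx_pos
  have py : ∀ i, 0 < vy i := fun i => (adm i).μy_pos
  have pL : ∀ i, 0 < vL i := fun i => (adm i).Lgy_pos
  have pU : ∀ i, 0 ≤ vU i := fun i => (adm i).U_nonneg
  have pa : ∀ i, 0 < va i := fun i => (adm i).α_pos hc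
  have pxi : ∀ i, 0 < (vx i)⁻¹ := fun i => inv_pos.2 (px i)
  have pyi : ∀ i, 0 < (vy i)⁻¹ := fun i => inv_pos.2 (py i)
  have hT : ∀ i, 1 ≤ T i := fun i => by
    have := px i; have := py i; have := pL i; have := pU i; have := pxi i; have := pyi i
    simp only [T]; linarith
  have base : ∀ {F : ι → ℝ}, (∀ i, 0 ≤ F i) → (∀ i, F i ≤ T i) → PolyBdd T F :=
    fun h0 h => PolyBdd.of_le_base h0 h
  have bU : PolyBdd T vU := base pU fun i => by
    have := px i; have := py i; have := pL i; have := pU i; have := pxi i; have := pyi i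
    simp only [T]; linarith
  have bL : PolyBdd T vL := base (fun i => (pL i).le) fun i => by
    have := px i; have := py i; have := pL i; have := pU i; have := pxi i; have := pyi i
    simp only [T]; linarith
  have bxi : PolyBdd T fun i => (vx i)⁻¹ := base (fun i => (pxi i).le) fun i => by
    have := px i; have := py i; have := pL i; have := pU i; have := pxi i; have := pyi i
    simp only [T]; linarith
  have byi : PolyBdd T fun i => (vy i)⁻¹ := base (fun i => (pyi i).le) fun i => by
    have := px i; have := py i; have := pL i; have := pU i; have := pxi i; have := pyi i
    simp only [T]; linarith
  have K : ∀ a : ℝ, PolyBdd T fun _ => a := PolyBdd.const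
  have bPhi : PolyBdd T fun i => smoothPhi Lx Lxy Ly Lgxy ρxy ρyy (vU i) (vy i) :=
    ((((K _).add hT ((K _).div byi)).add hT
      ((((bU.mul (K _)).div byi).add hT (((bU.mul (K _)).mul (K _)).div (byi.inv_pow 2))).mul
        ((K 1).add hT ((K _).div byi)))).add hT ((K _).div (byi.inv_pow 2)))
  have bai : PolyBdd T fun i => (va i)⁻¹ :=
    (bPhi.mul (K c⁻¹)).of_le (fun i => (inv_pos.2 (pa i)).le) fun i => (adm i).inv_α_le hc
  have ba : PolyBdd T va := bxi.of_le (fun i => (pa i).le) fun i => by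
    rw [← one_div, le_div_iff₀ (px i)]
    linarith [(adm i).α_mul_μx_le hc]
  have psq : ∀ i, 0 < √(va i * vx i) := fun i => Real.sqrt_pos.2 (mul_pos (pa i) (px i))
  have bs : PolyBdd T fun i => √(va i * vx i) / 2 :=
    (K 1).of_le (fun i => (half_pos (psq i)).le) fun i => by
      have := Real.sqrt_le_one.2 (((adm i).α_mul_μx_le hc).trans (by norm_num))
      linarith
  have bsi : PolyBdd T fun i => (√(va i * vx i) / 2)⁻¹ :=
    ((K 2).mul (bai.mul bxi)).of_le (fun i => (inv_pos.2 (half_pos (psq i))).le) fun i => by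
      -- As `α μx ≤ 1`, the inverse root is at most `1 / (α μx)`, and `1/α ≤ L_Φ / c` is
      -- polynomially bounded.
      have h1 : va i * vx i ≤ √(va i * vx i) := by
        have h2 := Real.sqrt_le_one.2 (((adm i).α_mul_μx_le hc).trans (by norm_num))
        have h3 := Real.mul_self_sqrt (mul_pos (pa i) (px i)).le
        nlinarith [psq i]
      rw [inv_div, ← mul_inv, ← div_eq_mul_inv]
      exact div_le_div_of_nonneg_left (by norm_num) (mul_pos (pa i) (px i)) h1
  have bk : PolyBdd T fun i => vL i / vy i := bL.div byi
  have bsk : PolyBdd T fun i => √(vL i / vy i) :=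
    bk.of_le (fun i => Real.sqrt_nonneg _) fun i => by
      have h1 := (adm i).one_le_κ
      rw [Real.sqrt_le_left (by linarith)]
      nlinarith
  have bc1 : PolyBdd T fun i => hyperLip Lxy Ly Lgxy ρxy ρyy (vU i) (vy i) :=
    ((K _).add hT (((K _).mul bU).div byi)).add hT
      ((K _).mul (((K _).div byi).add hT (((K _).mul bU).div (byi.inv_pow 2))))
  have bc2 : PolyBdd T fun i => va i / 2 + 2 * (√(va i * vx i) / 2) / vx i :=
    (ba.mul (K 2⁻¹)).add hT (((K 2).mul bs).div bxi)
  have bsx : PolyBdd T fun i => (√(va i * vx i) / 2 * vx i)⁻¹ := by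
    simpa only [mul_inv] using bsi.mul bxi
  have b1 : PolyBdd T fun i => innerRatio Lxy Ly Lgxy ρxy ρyy (vU i) (vL i) (vx i) (vy i) (va i) :=
    ((K 8).mul (bk.add hT (K 1))).mul (((bc2.mul (bc1.pow 2)).mul
      (((K 20).mul ((K 1).add hT (((K Lgxy).div byi).pow 2))).div bsx)).add hT (K 1))
  have b2 : PolyBdd T fun i => heavyBallRatio Lgxy (vU i) (vL i) (vx i) (vy i) (va i) :=
    (((K 8).mul bc2).div bsi).mul
      (((K Lgxy).mul (((K 2).mul (bsk.add hT (K 1))).mul (bU.div byi))).pow 2)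
  obtain ⟨A, hA, n, hn⟩ := b1
  obtain ⟨B, hB, m, hm⟩ := b2
  refine ⟨A + B, add_nonneg hA hB, n + m, fun U Lgy μx μy α h => ?_⟩
  let i : ι := ⟨(U, Lgy, μx, μy, α), h⟩
  have h0 : 0 ≤ T i := zero_le_one.trans (hT i)
  constructor
  · refine ((le_abs_self _).trans (hn i)).trans ?_
    exact mul_le_mul (le_add_of_nonneg_right hB)
      (pow_le_pow_right₀ (hT i) (Nat.le_add_right n m)) (by positivity) (add_nonneg hA hB)
  · refine ((le_abs_self _).trans (hm i)).trans ?_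
    exact mul_le_mul (le_add_of_nonneg_left hA)
      (pow_le_pow_right₀ (hT i) (Nat.le_add_left m n)) (by positivity) (add_nonneg hA hB)

end IsAdmissible

theorem exp_neg_ceil_mul_log_le {a P ε : ℝ} (ha : 0 < a) (hε : 0 < ε) (hP : 0 < P) :
    Real.exp (-((⌈a * Real.log (P / ε)⌉₊ : ℝ) / a)) ≤ ε / P := by
  have h1 := Nat.le_ceil (a * Real.log (P / ε))
  have h2 : Real.log (P / ε) ≤ (⌈a * Real.log (P / ε)⌉₊ : ℝ) / a := by
    rw [le_div_iff₀ ha]; linarith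
  calc _ ≤ Real.exp (-Real.log (P / ε)) := Real.exp_le_exp.2 (neg_le_neg h2)
    _ = _ := by rw [Real.exp_neg, Real.exp_log (div_pos hP hε), inv_div]

/-- A logarithm bounded below absorbs the additive constants: the rounding of the loop lengths and
the fixed cost per iteration. -/
theorem half_le_log_div {P ε : ℝ} (hε : 0 < ε) (hP : 2 * ε ≤ P) : 1 / 2 ≤ Real.log (P / ε) := by
  have h1 : (2 : ℝ) ≤ P / ε := (le_div_iff₀ hε).2 hP
  have h2 := Real.log_le_log two_pos h1
  linarith [Real.log_two_gt_d9]

/-- `L_Φ` grows like `μy⁻³`; with the `μy⁻¹` of `κ_y` this produces the `μy⁴` of the complexity. -/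
theorem smoothPhi_mul_le {Lx Lxy Ly Lgxy ρxy ρyy U μy D : ℝ} (hLx : 0 ≤ Lx) (hLxy : 0 ≤ Lxy)
    (hLy : 0 ≤ Ly) (hLgxy : 0 ≤ Lgxy) (hρxy : 0 ≤ ρxy) (hρyy : 0 ≤ ρyy) (hU : 0 ≤ U)
    (hμ : 0 < μy) (hD : μy ≤ D) :
    smoothPhi Lx Lxy Ly Lgxy ρxy ρyy U μy * μy ^ 3
      ≤ Lx * D ^ 3 + 2 * Lxy * Lgxy * D ^ 2 + (U * ρxy * D + U * Lgxy * ρyy) * (D + Lgxy)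
        + Lgxy ^ 2 * Ly * D := by
  have e : smoothPhi Lx Lxy Ly Lgxy ρxy ρyy U μy * μy ^ 3
      = Lx * μy ^ 3 + 2 * Lxy * Lgxy * μy ^ 2
        + (U * ρxy * μy + U * Lgxy * ρyy) * (μy + Lgxy) + Lgxy ^ 2 * Ly * μy := by
    rw [smoothPhi]; field_simp
  rw [e]
  have hD0 : 0 ≤ D := hμ.le.trans hD
  gcongr

/-- The total number of oracle calls for loops of logarithmic length. -/
theorem complexity_le {t c Q Lgy μx μy α l₁ l₂ : ℝ} {N M K : ℕ} (ht : 0 < t)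
    (hμx : 0 < μx) (hμy : 0 < μy) (hμL : μy ≤ Lgy) (hα : 0 < α) (hαμ : α * μx ≤ 1)
    (hQ : α⁻¹ * μy ^ 3 ≤ Q / c) (hl₁ : 1 / 2 ≤ l₁) (hl₂ : 1 / 2 ≤ l₂)
    (hN : N ≤ √(Lgy / μy) * l₂ + 1) (hM : M ≤ (√(Lgy / μy) + 1) * l₂ + 1)
    (hK : K ≤ 2 / (√(α * μx) / 2) * l₁ + 1) :
    (K : ℝ) * (t * (1 + M) + N + 2)
      ≤ (8 * (6 * t + 7) * √(Q / c) + 1) * √(Lgy / (μx * μy ^ 4)) * l₁ * l₂ := by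
  have ha0 : 0 < √(α * μx) := Real.sqrt_pos.2 (by positivity)
  have ha1 : √(α * μx) ≤ 1 := Real.sqrt_le_one.2 hαμ
  have hk1 : 1 ≤ √(Lgy / μy) := Real.one_le_sqrt.2 ((one_le_div hμy).2 hμL)
  set k := √(Lgy / μy) with hk
  have hkl : l₂ ≤ k * l₂ := le_mul_of_one_le_left (by linarith) hk1
  have h1 : t * (1 + M) + N + 2 ≤ (6 * t + 7) * (k * l₂) := by
    have : (1 + M : ℝ) ≤ 6 * (k * l₂) := by linarith
    have := mul_le_mul_of_nonneg_left this ht.le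
    linarith
  have h2 : (K : ℝ) ≤ 8 / √(α * μx) * l₁ := by
    have h3 : 1 ≤ 1 / √(α * μx) := (one_le_div ha0).2 ha1
    have h4 : l₁ ≤ 1 / √(α * μx) * l₁ := le_mul_of_one_le_left (by linarith) h3
    have h5 : 2 / (√(α * μx) / 2) * l₁ = 4 * (1 / √(α * μx) * l₁) := by ring
    have h6 : 8 / √(α * μx) * l₁ = 8 * (1 / √(α * μx) * l₁) := by ring
    rw [h6]
    linarith
  have h3 : k / √(α * μx) ≤ √(Q / c) * √(Lgy / (μx * μy ^ 4)) := by
    rw [hk, ← Real.sqrt_div (div_nonneg (hμy.le.trans hμL) hμy.le), ← Real.sqrt_mul]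
    · apply Real.sqrt_le_sqrt
      calc Lgy / μy / (α * μx) = (α⁻¹ * μy ^ 3) * (Lgy / (μx * μy ^ 4)) := by field_simp
        _ ≤ _ := by
          have : 0 ≤ Lgy := hμy.le.trans hμL
          gcongr
    · exact (by positivity : (0 : ℝ) ≤ α⁻¹ * μy ^ 3).trans hQ
  have hl₁0 : 0 ≤ l₁ := by linarith
  have hl₂0 : 0 ≤ l₂ := by linarith
  calc (K : ℝ) * (t * (1 + M) + N + 2)
      ≤ (8 / √(α * μx) * l₁) * ((6 * t + 7) * (k * l₂)) := by gcongr
    _ = 8 * (6 * t + 7) * (k / √(α * μx)) * l₁ * l₂ := by ring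
    _ ≤ 8 * (6 * t + 7) * (√(Q / c) * √(Lgy / (μx * μy ^ 4))) * l₁ * l₂ := by gcongr
    _ = (8 * (6 * t + 7) * √(Q / c)) * √(Lgy / (μx * μy ^ 4)) * l₁ * l₂ := by ring
    _ ≤ _ := by gcongr; linarith

/-- The polynomial `A (1 + ∑ Xᵢ)ⁿ`. -/
def sumPowPoly (k : ℕ) (A : ℝ) (n : ℕ) : MvPolynomial (Fin k) ℝ :=
  MvPolynomial.C A * (1 + ∑ i, MvPolynomial.X i) ^ n

theorem eval_sumPowPoly {k : ℕ} (A : ℝ) (n : ℕ) (v : Fin k → ℝ) :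
    MvPolynomial.eval v (sumPowPoly k A n) = A * (1 + ∑ i, v i) ^ n := by
  simp [sumPowPoly]

end Parameters
end Bilevel
end

noncomputable section
namespace Bilevel

/-! ### Loop lengths that reach accuracy `ε`. -/

namespace IsSCSC
variable {p q : ℕ} {Lx Lxy Ly Lgxy Lgy ρxy ρyy μx μy U : ℝ} {f g : E p → E q → ℝ}

/-- AccBiO-BG with loops of logarithmic length reaches accuracy `ε`. -/
theorem accBiOBG_le_eps (h : IsSCSC Lx Lxy Ly Lgxy Lgy ρxy ρyy μx μy f g) (hLxy : 0 ≤ Lxy)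
    (hLy : 0 ≤ Ly) (hLgxy : 0 ≤ Lgxy) (hρxy : 0 ≤ ρxy) (hρyy : 0 ≤ ρyy)
    (hU : ∀ x y, ‖gradY f x y‖ ≤ U) {c α : ℝ} (hc : 0 < c)
    (hadm : IsAdmissible Lx Lxy Ly Lgxy ρxy ρyy c U Lgy μx μy α) {ε D P₁ P₂ : ℝ} (hε : 0 < ε)
    (hεD : ε ≤ D) (hP₂0 : ε ≤ P₂) (hP₂ : D * innerRatio Lxy Ly Lgxy ρxy ρyy U Lgy μx μy α ≤ P₂)
    (hP₂' : heavyBallRatio Lgxy U Lgy μx μy α ≤ P₂) {xs : E p}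
    (hxs : IsMinOn (objective f g) Set.univ xs) {Δ r : ℝ}
    (hΔ : objective f g 0 - objective f g xs ≤ Δ) (hr : ‖lowerSol g 0‖ ≤ r)
    (hP₁0 : ε ≤ P₁) (hP₁ : 2 * (2 * Δ + μx * r ^ 2) ≤ P₁) :
    objective f g
        (accBiOBG (scscParams Lgy μx μy α ⌈√(Lgy / μy) * Real.log (P₂ / ε)⌉₊
          (⌈(√(Lgy / μy) + 1) * Real.log (P₂ / ε)⌉₊ + 1)) f g
          ⌈2 / (√(α * μx) / 2) * Real.log (P₁ / ε)⌉₊).z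
      - objective f g xs ≤ ε := by
  have hμx := hadm.μx_pos
  have hμ := hadm.μy_pos
  have hα := hadm.α_pos hc
  have hU0 := hadm.U_nonneg
  have ha0 : 0 < √(α * μx) := Real.sqrt_pos.2 (by positivity)
  have ha1 : √(α * μx) ≤ 1 :=
    Real.sqrt_le_one.2 ((hadm.α_mul_μx_le hc).trans (by norm_num))
  have hk1 : 1 ≤ √(Lgy / μy) := Real.one_le_sqrt.2 hadm.one_le_κ
  have hκ := hadm.one_le_κ
  have hP₂pos : 0 < P₂ := hε.trans_le hP₂0
  have hP₁pos : 0 < P₁ := hε.trans_le hP₁0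
  have hexpN := exp_neg_ceil_mul_log_le (a := √(Lgy / μy)) (by linarith) hε hP₂pos
  have hexpM := exp_neg_ceil_mul_log_le (a := √(Lgy / μy) + 1) (by linarith) hε hP₂pos
  have hexpK := exp_neg_ceil_mul_log_le (a := 2 / (√(α * μx) / 2)) (by positivity) hε hP₁pos
  set N := ⌈√(Lgy / μy) * Real.log (P₂ / ε)⌉₊
  set M' := ⌈(√(Lgy / μy) + 1) * Real.log (P₂ / ε)⌉₊
  set K := ⌈2 / (√(α * μx) / 2) * Real.log (P₁ / ε)⌉₊
  have hN1 : (1 - 1 / √(Lgy / μy)) ^ N ≤ ε / P₂ := by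
    refine le_trans ?_ hexpN
    have h1 : 0 ≤ 1 - 1 / √(Lgy / μy) := sub_nonneg.2 ((div_le_one (by linarith)).2 hk1)
    calc _ ≤ Real.exp (-(1 / √(Lgy / μy))) ^ N :=
          pow_le_pow_left₀ h1 (Real.one_sub_le_exp_neg _) N
      _ = _ := by rw [← Real.exp_nat_mul]; congr 1; ring
  have hK1 : (1 - √(α * μx) / 2 / 2) ^ K ≤ ε / P₁ := by
    refine le_trans ?_ hexpK
    calc _ ≤ Real.exp (-(√(α * μx) / 2 / 2)) ^ K :=
          pow_le_pow_left₀ (by linarith) (Real.one_sub_le_exp_neg _) K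
      _ = _ := by rw [← Real.exp_nat_mul]; congr 1; field_simp
  rw [innerRatio] at hP₂
  rw [heavyBallRatio] at hP₂'
  set c₁ := hyperLip Lxy Ly Lgxy ρxy ρyy U μy with hc₁
  set τ := √(α * μx) / 2 with hτ
  have hτ0 : 0 < τ := by positivity
  set c₂ := α / 2 + 2 * τ / μx with hc₂
  have hc₂0 : 0 < c₂ := by positivity
  set l := Lgxy / μy with hl
  -- `M' + 1`, because the heavy-ball loop makes `M - 1` updates. The target splits into `ε/2` for
  -- the initial value and `ε/2` for the accumulated error.
  have hmain := h.accBiOBG_sub_min_le (N := N) (M := M' + 1) hμx hμ hLxy hLy hLgxy hρxy hρyy hU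
    hadm.μy_le hα hadm.α_mul_le hτ hl rfl hc₁ hc₂ ?_ rfl hxs hΔ hr K
  · refine hmain.trans ?_
    rw [Nat.add_sub_cancel]
    have k1 : (1 - τ / 2) ^ K * (2 * Δ + μx * r ^ 2) ≤ ε / 2 := by
      have hΔ0 : 0 ≤ 2 * Δ + μx * r ^ 2 := by
        have : objective f g xs ≤ objective f g 0 := hxs (Set.mem_univ _)
        have : 0 ≤ Δ := by linarith
        positivity
      calc _ ≤ ε / P₁ * (P₁ / 2) := by
            refine mul_le_mul hK1 (by linarith) hΔ0 (by positivity)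
        _ = _ := by field_simp
    set B := Lgxy * (2 * (√(Lgy / μy) + 1) * (U / μy)) with hB
    set x := Real.exp (-((M' : ℝ) / (√(Lgy / μy) + 1)))
    have hx0 : 0 < x := Real.exp_pos _
    have hx1 : x ≤ 1 := hexpM.trans ((div_le_one hP₂pos).2 hP₂0)
    have k2 : 4 * c₂ * (Lgxy * (2 * (√(Lgy / μy) + 1) * x * (U / μy))) ^ 2 / τ ≤ ε / 2 := by
      have e1 : 4 * c₂ * (Lgxy * (2 * (√(Lgy / μy) + 1) * x * (U / μy))) ^ 2 / τ
          = 8 * c₂ / τ * B ^ 2 * (x * x) / 2 := by rw [hB]; ring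
      rw [e1]
      have e2 : 0 ≤ 8 * c₂ / τ * B ^ 2 := by positivity
      -- The error enters squared, but one factor suffices; the other is only bounded by 1.
      have e3 : x * x ≤ ε / P₂ := (mul_le_of_le_one_right hx0.le hx1).trans hexpM
      have e4 : 8 * c₂ / τ * B ^ 2 * (x * x) ≤ P₂ * (ε / P₂) :=
        mul_le_mul hP₂' e3 (by positivity) hP₂pos.le
      rw [mul_div_cancel₀ _ hP₂pos.ne'] at e4
      linarith
    linarith
  · have hinv : τ * μx / (20 * (1 + l ^ 2)) = (20 * (1 + l ^ 2) / (τ * μx))⁻¹ := by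
      rw [inv_div]
    have hA0 : 0 < 20 * (1 + l ^ 2) / (τ * μx) := by positivity
    rw [hinv]
    set A := 20 * (1 + l ^ 2) / (τ * μx)
    set R := 8 * (Lgy / μy + 1) * (c₂ * c₁ ^ 2 * A + 1) with hR
    have hR0 : 0 ≤ R := by positivity
    calc 8 * (c₂ * c₁ ^ 2 + A⁻¹) * ((Lgy / μy + 1) * (1 - 1 / √(Lgy / μy)) ^ N)
        ≤ 8 * (c₂ * c₁ ^ 2 + A⁻¹) * ((Lgy / μy + 1) * (ε / P₂)) := by gcongr
      _ = R * ε / P₂ * A⁻¹ := by rw [hR]; field_simp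
      _ ≤ 1 * A⁻¹ := by
        gcongr
        rw [div_le_one hP₂pos]
        -- The inner contraction is needed only to the fixed ratio `1 / R`; `ε ≤ D` lets `P₂ ≥ D R`
        -- ensure it with the same logarithm as the heavy-ball loop.
        refine le_trans ?_ hP₂
        rw [mul_comm]
        gcongr
      _ = A⁻¹ := one_mul _

end IsSCSC
end Bilevel
end
-- The theorem.
theorem mainTheorem5
    -- the constants of the problem class that the `O(·)` may depend on
    (Lx Lxy Ly Lgxy ρxy ρyy : ℝ)
    (hLx : 0 ≤ Lx) (hLxy : 0 ≤ Lxy) (hLy : 0 ≤ Ly) (hLgxy : 0 ≤ Lgxy)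
    (hρxy : 0 ≤ ρxy) (hρyy : 0 ≤ ρyy)
    -- `t`: cost of a Jacobian- or Hessian-vector product; `c`: the stepsize is at least `c / L_Φ`;
    -- `D`: any a priori upper bound for `μ_y` and `ε`
    (t : ℝ) (ht : 0 < t) (c : ℝ) (hc : 0 < c) (D : ℝ) (hD : 0 < D) :
    ∃ (P₁ : MvPolynomial (Fin 8) ℝ) (P₂ : MvPolynomial (Fin 6) ℝ),
    ∀ U : ℝ, 0 ≤ U → ∃ C : ℝ, 0 < C ∧
    ∀ Lgy μx μy ε α : ℝ, 0 < μx → 0 < μy → μy ≤ D → 0 < ε → ε ≤ D →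
      c / Bilevel.smoothPhi Lx Lxy Ly Lgxy ρxy ρyy U μy ≤ α →
      α ≤ 1 / (2 * Bilevel.smoothPhi Lx Lxy Ly Lgxy ρxy ρyy U μy) →
    ∃ N M : ℕ, ∀ Δ r : ℝ, ∃ K : ℕ,
    ∀ (p q : ℕ) (f g : Bilevel.E p → Bilevel.E q → ℝ) (xs : Bilevel.E p), 1 ≤ q →
      Bilevel.IsSCSC Lx Lxy Ly Lgxy Lgy ρxy ρyy μx μy f g →
      (∀ x y, ‖Bilevel.gradY f x y‖ ≤ U) →
      IsMinOn (Bilevel.objective f g) Set.univ xs →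
      Bilevel.objective f g 0 - Bilevel.objective f g xs ≤ Δ →
      ‖Bilevel.lowerSol g 0‖ ≤ r →
      -- `Φ` is differentiable and `L_Φ`-smooth
      (Differentiable ℝ (Bilevel.objective f g) ∧
        ∀ x₁ x₂, ‖gradient (Bilevel.objective f g) x₁ - gradient (Bilevel.objective f g) x₂‖
          ≤ Bilevel.smoothPhi Lx Lxy Ly Lgxy ρxy ρyy U μy * ‖x₁ - x₂‖) ∧
      -- the output is `ε`-optimal
      Bilevel.objective f g
          (Bilevel.accBiOBG (Bilevel.scscParams Lgy μx μy α N M) f g K).z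
        - Bilevel.objective f g xs ≤ ε ∧
      -- both logarithms below are positive
      ε < MvPolynomial.eval ![μx, μx⁻¹, μy, μy⁻¹, Lgy, U, Δ, r] P₁ ∧
      ε < MvPolynomial.eval ![μx, μx⁻¹, μy, μy⁻¹, Lgy, U] P₂ ∧
      -- and it is reached within the claimed complexity
      (Bilevel.accBiOBG (Bilevel.scscParams Lgy μx μy α N M) f g K).complexity t
        ≤ C * √(Lgy / (μx * μy ^ 4))
          * Real.log (MvPolynomial.eval ![μx, μx⁻¹, μy, μy⁻¹, Lgy, U, Δ, r] P₁ / ε)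
          * Real.log (MvPolynomial.eval ![μx, μx⁻¹, μy, μy⁻¹, Lgy, U] P₂ / ε) := by
  obtain ⟨A, hA, n, hAn⟩ :=
    Bilevel.IsAdmissible.exists_bound Lx Lxy Ly Lgxy ρxy ρyy c hc
  -- In `P₁`, degree 3 and the 6 come from `4Δ + 2 μx r²`. In `P₂`, `A` serves the heavy-ball ratio
  -- and `D * A` the inner ratio. The `2 * D` in both gives at least `2ε`.
  refine ⟨Bilevel.sumPowPoly 8 (6 + 2 * D) 3, Bilevel.sumPowPoly 6 (A + D * A + 2 * D) n,
    fun U hU => ?_⟩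
  set Q := Lx * D ^ 3 + 2 * Lxy * Lgxy * D ^ 2 + (U * ρxy * D + U * Lgxy * ρyy) * (D + Lgxy)
    + Lgxy ^ 2 * Ly * D with hQ
  refine ⟨8 * (6 * t + 7) * √(Q / c) + 1, by positivity, ?_⟩
  intro Lgy μx μy ε α hμx hμy hμyD hε hεD hcα hα
  -- `N`, `M`, `K` are chosen before any problem is given. If these inequalities fail the class is
  -- empty and any choice will do.
  by_cases hle : μy ≤ Lgy ∧ μx ≤ Bilevel.smoothPhi Lx Lxy Ly Lgxy ρxy ρyy U μy
  swap
  · refine ⟨0, 0, fun Δ r => ⟨0, fun p q f g xs hq h hfU => ?_⟩⟩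
    exact absurd ⟨h.μy_le hq, h.μx_le hμy hLxy hLy hLgxy hρxy hρyy hfU⟩ hle
  have hadm : Bilevel.IsAdmissible Lx Lxy Ly Lgxy ρxy ρyy c U Lgy μx μy α :=
    ⟨hU, hμx, hμy, hle.1, hle.2, hcα, hα⟩
  obtain ⟨hA1, hA2⟩ := hAn U Lgy μx μy α hadm
  have hα0 := hadm.α_pos hc
  have hLgy := hadm.Lgy_pos
  have eP₂ : MvPolynomial.eval ![μx, μx⁻¹, μy, μy⁻¹, Lgy, U]
      (Bilevel.sumPowPoly 6 (A + D * A + 2 * D) n)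
      = (A + D * A + 2 * D) * (1 + (μx + μx⁻¹ + μy + μy⁻¹ + Lgy + U)) ^ n := by
    rw [Bilevel.eval_sumPowPoly]
    simp [Fin.sum_univ_succ, add_assoc]
  have hT : 1 ≤ (1 + (μx + μx⁻¹ + μy + μy⁻¹ + Lgy + U)) ^ n :=
    one_le_pow₀ (le_add_of_nonneg_right (by positivity))
  set P₂ := MvPolynomial.eval ![μx, μx⁻¹, μy, μy⁻¹, Lgy, U]
    (Bilevel.sumPowPoly 6 (A + D * A + 2 * D) n)
  set T := (1 + (μx + μx⁻¹ + μy + μy⁻¹ + Lgy + U)) ^ n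
  have hAT : 0 ≤ A * T := by positivity
  have hDAT : 0 ≤ D * (A * T) := by positivity
  have hDT : D ≤ D * T := le_mul_of_one_le_right hD.le hT
  have hP₂ε : 2 * ε ≤ P₂ := by rw [eP₂]; linarith
  have hP₂a : D * Bilevel.innerRatio Lxy Ly Lgxy ρxy ρyy U Lgy μx μy α ≤ P₂ := by
    have := mul_le_mul_of_nonneg_left hA1 hD.le
    rw [eP₂]; linarith
  have hP₂b : Bilevel.heavyBallRatio Lgxy U Lgy μx μy α ≤ P₂ := by rw [eP₂]; linarith
  refine ⟨⌈√(Lgy / μy) * Real.log (P₂ / ε)⌉₊, ⌈(√(Lgy / μy) + 1) * Real.log (P₂ / ε)⌉₊ + 1,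
    fun Δ r => ?_⟩
  have eP₁ : MvPolynomial.eval ![μx, μx⁻¹, μy, μy⁻¹, Lgy, U, Δ, r]
      (Bilevel.sumPowPoly 8 (6 + 2 * D) 3)
      = (6 + 2 * D) * (1 + (μx + μx⁻¹ + μy + μy⁻¹ + Lgy + U + Δ + r)) ^ 3 := by
    rw [Bilevel.eval_sumPowPoly]
    simp [Fin.sum_univ_succ, add_assoc]
  set P₁ := MvPolynomial.eval ![μx, μx⁻¹, μy, μy⁻¹, Lgy, U, Δ, r]
    (Bilevel.sumPowPoly 8 (6 + 2 * D) 3)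
  refine ⟨⌈2 / (√(α * μx) / 2) * Real.log (P₁ / ε)⌉₊, ?_⟩
  intro p q f g xs hq h hfU hxs hΔ hr
  have hΔ0 : 0 ≤ Δ := by
    have : Bilevel.objective f g xs ≤ Bilevel.objective f g 0 := hxs (Set.mem_univ _)
    linarith
  have hr0 : 0 ≤ r := (norm_nonneg _).trans hr
  have hP₁ : 2 * ε ≤ P₁ ∧ 2 * (2 * Δ + μx * r ^ 2) ≤ P₁ := by
    rw [eP₁]
    have hμxi : 0 < μx⁻¹ := inv_pos.2 hμx
    have hμyi : 0 < μy⁻¹ := inv_pos.2 hμy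
    set s := 1 + (μx + μx⁻¹ + μy + μy⁻¹ + Lgy + U + Δ + r) with hs
    have hs1 : 1 ≤ s := by linarith
    have hs3 : 1 ≤ s ^ 3 := one_le_pow₀ hs1
    have hss : s ≤ s ^ 3 := le_self_pow₀ hs1 (by norm_num)
    have hDs : D ≤ D * s ^ 3 := le_mul_of_one_le_right hD.le hs3
    have hΔs : Δ ≤ s := by linarith
    have hμr : μx * r ^ 2 ≤ s * s ^ 2 := by
      gcongr <;> linarith
    have hμr' : μx * r ^ 2 ≤ s ^ 3 := hμr.trans (le_of_eq (by ring))
    constructor <;> linarith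
  obtain ⟨hP₁ε, hP₁a⟩ := hP₁
  refine ⟨⟨h.differentiable_objective hμy,
    h.gradient_objective_lip hμy hLxy hLy hLgxy hρxy hρyy hfU⟩, ?_, by linarith, by linarith, ?_⟩
  · exact h.accBiOBG_le_eps hLxy hLy hLgxy hρxy hρyy hfU hc hadm hε hεD (by linarith) hP₂a hP₂b hxs
      hΔ hr (by linarith) hP₁a
  · rw [Bilevel.accBiOBG_complexity]
    have hl₁ := Bilevel.half_le_log_div hε hP₁ε
    have hl₂ := Bilevel.half_le_log_div hε hP₂ε
    refine Bilevel.complexity_le ht hμx hμy hle.1 hα0 ((hadm.α_mul_μx_le hc).trans (by norm_num))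
      ?_ hl₁ hl₂ ?_ ?_ ?_
    · have h1 := mul_le_mul_of_nonneg_right (hadm.inv_α_le hc) (pow_nonneg hμy.le 3)
      refine h1.trans ?_
      rw [div_mul_eq_mul_div]
      exact div_le_div_of_nonneg_right
        (Bilevel.smoothPhi_mul_le hLx hLxy hLy hLgxy hρxy hρyy hU hμy hμyD) hc.le
    · exact (Nat.ceil_lt_add_one (by positivity)).le
    · exact (Nat.ceil_lt_add_one (by positivity)).le
    · exact (Nat.ceil_lt_add_one (by positivity)).le
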